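/- Let $p$ be a prime and let $G$ be a uniform pro-$p$ group of some dimension $l$, i.e. a pro-$p$ group that is topologically generated by $l$ elements and satisfies $G^{p^n}/G^{p^{n+1}}\cong(\mathbb{Z}/p\mathbb{Z})^l$ for all $n\ge 0$, where $G^{p^n}$ is the closed subgroup generated by the $p^n$-th powers. Let $X$ be a finite multigraph with vertex set $V$, fix an orientation of each edge, and let $\alpha$ be a voltage assignment, i.e. a map from the set of edges to $G$. For a quotient $A$ of $G$, the derived graph $X(A)$ has vertex set $V\times A$, and each edge $e$ of $X$ from $v$ to $w$ gives an edge from $(v,a)$ to $(w,a\bar\alpha(e))$ for every $a\in A$, where $\bar\alpha(e)$ is the image of $\alpha(e)$ in $A$. Put $X_n=X(G/G^{p^n})$ and $X_\infty=X(G)$, and assume that every $X_n$, $n\ge 0$, is connected. Let $H\subseteq G$ be a normal subgroup such that $G/H\cong\mathbb{Z}_p$ as topological groups, and put $Y=X(G/H)$, the $\mathbb{Z}_p$-subcover of $X_\infty/X$ fixed by $H$. Let $\Lambda=\mathbb{Z}_p[[G]]$ and $\Lambda_1=\mathbb{Z}_p[[G/H]]$. For a locally finite multigraph $Z$ let $\mathrm{Pic}(Z)=\mathrm{Div}(Z)/\mathrm{Pr}(Z)$,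 where $\mathrm{Div}(Z)$ is the free $\mathbb{Z}_p$-module on the vertices of $Z$ and $\mathrm{Pr}(Z)$ is the $\mathbb{Z}_p$-submodule generated by the divisors $\sum_{v\to w}(v-w)$, one for each vertex $v$, the sum being over all directed edges starting at $v$ (an undirected loop counts as two directed edges). The group $A$ acts on $\mathrm{Pic}(X(A))$ through $g(v,a)=(v,ga)$. Put $$\mathrm{Pic}_\infty=\Lambda\otimes_{\mathbb{Z}_p[G]}\mathrm{Pic}(X_\infty),\qquad \mathrm{Pic}_Y=\Lambda_1\otimes_{\mathbb{Z}_p[G/H]}\mathrm{Pic}(Y).$$ For a finitely generated $\Lambda_1$-module $M$ with $p$-power torsion submodule $M[p^\infty]$ let $$\mu_{\Lambda_1}(M)=\sum_{i\ge 0}\mathrm{rank}_{\mathbb{F}_p[[G/H]]}\bigl(p^iM[p^\infty]/p^{i+1}M[p^\infty]\bigr).$$ If $\mu_{\Lambda_1}(\mathrm{Pic}_Y)=0$, then $\mathrm{Pic}_\infty$ satisfies the $\mathfrak{M}_H(G)$-property, i.e. $\mathrm{Pic}_\infty/\mathrm{Pic}_\infty[p^\infty]$ is finitely generated over $\mathbb{Z}_p[[H]]$;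 moreover, $\mathrm{Pic}_\infty$ itself is finitely generated over $\mathbb{Z}_p[[H]]$. -/

import Mathlib

noncomputable section

namespace VoltageCover

open scoped TensorProduct

/-! ### Completed group rings -/

section IwasawaAlgebra

variable (p : ℕ) [Fact p.Prime]

section

variable (G : Type*) [Group G] [TopologicalSpace G]

/-- The natural map `ℤ_p[G/U] → ℤ_p[G/V]` for open normal subgroups `U ≤ V`. -/
def transition {U V : OpenNormalSubgroup G} (h : U ≤ V) :
    MonoidAlgebra ℤ_[p] (G ⧸ U.toSubgroup) →ₐ[ℤ_[p]] MonoidAlgebra ℤ_[p] (G ⧸ V.toSubgroup) :=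
  MonoidAlgebra.mapDomainAlgHom ℤ_[p] ℤ_[p]
    (QuotientGroup.map U.toSubgroup V.toSubgroup (MonoidHom.id G) h)

/-- The completed group ring `ℤ_p⟦G⟧`: the inverse limit of the group rings `ℤ_p[G/U]` over all
open normal subgroups `U` of `G`, realised as the ring of compatible families. -/
abbrev IwasawaAlgebra : Type _ :=
  ({ carrier := {x | ∀ (U V : OpenNormalSubgroup G) (h : U ≤ V), transition p G h (x U) = x V}
     mul_mem' := fun {a b} ha hb U V h => by simp [ha U V h, hb U V h]
     add_mem' := fun {a b} ha hb U V h => by simp [ha U V h, hb U V h]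
     algebraMap_mem' := fun r U V h => (transition p G h).commutes r } :
    Subalgebra ℤ_[p] ((U : OpenNormalSubgroup G) → MonoidAlgebra ℤ_[p] (G ⧸ U.toSubgroup)))

/-- The natural map `ℤ_p[G] → ℤ_p⟦G⟧`. -/
def toIwasawaAlgebra : MonoidAlgebra ℤ_[p] G →+* IwasawaAlgebra p G where
  toFun r := ⟨fun U => MonoidAlgebra.mapDomainAlgHom ℤ_[p] ℤ_[p]
    (QuotientGroup.mk' U.toSubgroup) r, fun U V h => by
      simp only [transition, ← AlgHom.comp_apply, ← MonoidAlgebra.mapDomainAlgHom_comp]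
      rfl⟩
  map_one' := by ext1; funext U; exact map_one _
  map_mul' a b := by ext1; funext U; exact map_mul _ a b
  map_zero' := by ext1; funext U; exact map_zero _
  map_add' a b := by ext1; funext U; exact map_add _ a b

end

section

variable {G G' : Type*} [Group G] [TopologicalSpace G] [Group G'] [TopologicalSpace G']

/-- The preimage of an open normal subgroup under a continuous homomorphism. -/
def comapOpenNormal (f : G →* G') (hf : Continuous f) (U : OpenNormalSubgroup G') :
    OpenNormalSubgroup G where
  toOpenSubgroup := U.toOpenSubgroup.comap f hf
  isNormal' := (inferInstance : (U.toSubgroup.comap f).Normal)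

/-- The ring homomorphism `ℤ_p⟦G⟧ → ℤ_p⟦G'⟧` induced by a continuous homomorphism `f : G → G'`;
its component at `U` is the composite `ℤ_p⟦G⟧ → ℤ_p[G/f⁻¹(U)] → ℤ_p[G'/U]`. -/
def IwasawaAlgebra.map (f : G →* G') (hf : Continuous f) :
    IwasawaAlgebra p G →+* IwasawaAlgebra p G' where
  toFun x := ⟨fun U => MonoidAlgebra.mapDomainAlgHom ℤ_[p] ℤ_[p]
      (QuotientGroup.map (comapOpenNormal f hf U).toSubgroup U.toSubgroup f le_rfl)
      (x.1 (comapOpenNormal f hf U)), fun U V h => by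
    have h' : comapOpenNormal f hf U ≤ comapOpenNormal f hf V := fun g hg => h hg
    beta_reduce
    rw [← x.2 _ _ h']
    simp only [transition, ← AlgHom.comp_apply, ← MonoidAlgebra.mapDomainAlgHom_comp]
    congr 2
    ext g
    rfl⟩
  map_one' := by ext1; funext U; exact map_one _
  map_mul' a b := by ext1; funext U; exact map_mul _ _ _
  map_zero' := by ext1; funext U; exact map_zero _
  map_add' a b := by ext1; funext U; exact map_add _ _ _

end

end IwasawaAlgebra

/-! ### Uniform pro-`p` groups -/

section Uniform

variable (p : ℕ) (G : Type*) [Group G] [TopologicalSpace G] [IsTopologicalGroup G]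

/-- `G^{p^n}`: the closed subgroup of `G` generated by all `p^n`-th powers. -/
def powerSubgroup (n : ℕ) : Subgroup G :=
  (Subgroup.closure (Set.range fun g : G => g ^ p ^ n)).topologicalClosure

instance powerSubgroup_normal (n : ℕ) : (powerSubgroup p G n).Normal := by
  have : (Subgroup.closure (Set.range fun g : G => g ^ p ^ n)).Normal := by
    constructor
    intro x hx g
    induction hx using Subgroup.closure_induction with
    | mem x hx =>
      obtain ⟨y, rfl⟩ := hx
      exact Subgroup.subset_closure ⟨g * y * g⁻¹, by simp [conj_pow]⟩
    | one => simp
    | mul x y _ _ hx hy =>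
      have : g * (x * y) * g⁻¹ = (g * x * g⁻¹) * (g * y * g⁻¹) := by group
      rw [this]; exact mul_mem hx hy
    | inv x _ hx =>
      have : g * x⁻¹ * g⁻¹ = (g * x * g⁻¹)⁻¹ := by group
      rw [this]; exact inv_mem hx
  exact Subgroup.is_normal_topologicalClosure _

/-- A profinite group `G` is a uniform pro-`p` group of dimension `l` if it is pro-`p`,
topologically generated by `l` elements, and `G^{p^n}/G^{p^(n+1)} ≅ (ℤ/pℤ)^l` for all `n`. -/
structure IsUniform (l : ℕ) : Prop where
  compactSpace : CompactSpace G
  t2Space : T2Space G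
  totallyDisconnectedSpace : TotallyDisconnectedSpace G
  proP : ∀ U : OpenNormalSubgroup G, IsPGroup p (G ⧸ U.toSubgroup)
  generated : ∃ s : Fin l → G, (Subgroup.closure (Set.range s)).topologicalClosure = ⊤
  powers_le : ∀ n, powerSubgroup p G (n + 1) ≤ powerSubgroup p G n
  graded : ∀ n, Nonempty
    ((powerSubgroup p G n ⧸ (powerSubgroup p G (n + 1)).subgroupOf (powerSubgroup p G n)) ≃*
      Multiplicative (Fin l → ZMod p))

end Uniform

/-! ### Invariants of modules over completed group rings -/

section Modules

variable (p : ℕ) (A : Type*) [Ring A] (M : Type*) [AddCommGroup M] [Module A M]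

/-- The submodule `M[p^∞]` of all elements killed by a power of `p`. -/
def pPrimary : Submodule A M where
  carrier := {m | ∃ n : ℕ, p ^ n • m = 0}
  zero_mem' := ⟨0, smul_zero _⟩
  add_mem' := by
    rintro a b ⟨m, hm⟩ ⟨n, hn⟩
    refine ⟨m + n, ?_⟩
    rw [smul_add, pow_add, mul_smul, mul_smul, hn, smul_zero, add_zero, smul_comm, hm, smul_zero]
  smul_mem' := by
    rintro c x ⟨n, hn⟩
    exact ⟨n, by rw [smul_comm, hn, smul_zero]⟩

variable {A M} in
/-- The submodule `p^i N` of `M`, for a submodule `N` of `M`. -/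
def pPowMul (i : ℕ) (N : Submodule A M) : Submodule A M :=
  N.map (p ^ i • (LinearMap.id : M →ₗ[A] M))

/-- The quotient `p^i M[p^∞] / p^(i+1) M[p^∞]`. -/
abbrev gradedPiece (i : ℕ) : Type _ :=
  pPowMul p i (pPrimary p A M) ⧸
    (pPowMul p (i + 1) (pPrimary p A M)).submoduleOf (pPowMul p i (pPrimary p A M))

instance isTwoSided_span_natCast : (Ideal.span {(p : A)}).IsTwoSided := by
  constructor
  intro a b ha
  rw [Ideal.mem_span_singleton'] at ha ⊢
  obtain ⟨c, rfl⟩ := ha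
  exact ⟨c * b, by rw [mul_assoc, mul_assoc, (Nat.cast_commute p b).eq]⟩

lemma gradedPiece_isTorsion (i : ℕ) :
    Module.IsTorsionBySet A (gradedPiece p A M i) (Ideal.span {(p : A)}) := by
  rw [← Module.isTorsionBySet_iff_is_torsion_by_span]
  rintro x ⟨a, rfl⟩
  obtain ⟨⟨y, hy⟩, rfl⟩ := Submodule.Quotient.mk_surjective _ x
  rw [← Submodule.Quotient.mk_smul, Submodule.Quotient.mk_eq_zero]
  obtain ⟨z, hz, rfl⟩ := hy
  exact ⟨z, hz, by simp [pow_succ', mul_smul, Nat.cast_smul_eq_nsmul]⟩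

/-- `p^i M[p^∞] / p^(i+1) M[p^∞]` as a module over `A/pA`. -/
instance gradedPieceModule (i : ℕ) :
    Module (A ⧸ Ideal.span {(p : A)}) (gradedPiece p A M i) :=
  (gradedPiece_isTorsion p A M i).module

/-- The `μ`-invariant `∑_{i ≥ 0} rank (p^i M[p^∞] / p^(i+1) M[p^∞])`, the ranks being taken over
`A/pA`. For `A = ℤ_p⟦G⟧` this ring is `𝔽_p⟦G⟧`; the rank is the maximal number of linearly
independent elements, which is the dimension after extension of scalars to the skew field of
fractions whenever the latter exists. The sum is formed in `ℕ∞`, so that it always makes sense. -/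
def muInvariant : ℕ∞ :=
  ∑' i : ℕ, Cardinal.toENat (Module.rank (A ⧸ Ideal.span {(p : A)}) (gradedPiece p A M i))

end Modules

section FiniteOverSubgroup

variable (p : ℕ) [Fact p.Prime] {G : Type*} [Group G] [TopologicalSpace G]
  (H : Subgroup G) (M : Type*) [AddCommGroup M] [Module (IwasawaAlgebra p G) M]

/-- The `ℤ_p⟦G⟧`-module `M` is finitely generated as a `ℤ_p⟦H⟧`-module, by restriction of scalars
along `ℤ_p⟦H⟧ → ℤ_p⟦G⟧`. -/
def IsFinitelyGeneratedOver : Prop :=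
  letI : Module (IwasawaAlgebra p H) M :=
    Module.compHom M (IwasawaAlgebra.map p H.subtype continuous_subtype_val)
  Module.Finite (IwasawaAlgebra p H) M

/-- The `𝔐_H(G)`-property: `M/M[p^∞]` is finitely generated over `ℤ_p⟦H⟧`. -/
def SatisfiesMHG : Prop :=
  IsFinitelyGeneratedOver p H (M ⧸ pPrimary p (IwasawaAlgebra p G) M)

end FiniteOverSubgroup

/-! ### Extension of scalars over noncommutative rings -/

section ScalarExtension

variable {R A : Type*} [Ring R] [Ring A] (f : R →+* A) (N : Type*) [AddCommGroup N] [Module R N]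

/-- The `A`-submodule of `A ⊗_ℤ N` generated by all `a f(r) ⊗ n - a ⊗ r n`. -/
def balancing : Submodule A (A ⊗[ℤ] N) :=
  Submodule.span A {z | ∃ (a : A) (r : R) (n : N), z = (a * f r) ⊗ₜ[ℤ] n - a ⊗ₜ[ℤ] (r • n)}

/-- The left `A`-module `A ⊗_R N`, for a ring homomorphism `f : R → A` and a left `R`-module
`N`. -/
abbrev ScalarExtension : Type _ := (A ⊗[ℤ] N) ⧸ balancing f N

end ScalarExtension

/-! ### Graphs, divisors and voltage covers -/

/-- A locally finite undirected multigraph (loops and multiple edges allowed) with vertex set `V`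
and edge set `E`, together with a choice of orientation of every edge, which serves to write
down voltage assignments. -/
structure Multigraph (V E : Type*) where
  src : E → V
  tgt : E → V
  finite_src : ∀ v, {e | src e = v}.Finite
  finite_tgt : ∀ v, {e | tgt e = v}.Finite

namespace Multigraph

section Divisors

variable (k : Type*) [CommRing k] {V E : Type*} (X : Multigraph V E)

/-- A multigraph is connected if it is nonempty and any two vertices are joined by a path, where
edges can be traversed in both directions. -/
def Connected : Prop :=
  Nonempty V ∧ ∀ v w : V, Relation.EqvGen (fun a b => ∃ e, X.src e = a ∧ X.tgt e = b) v w

/-- The firing move at `v`: the divisor `∑ (v - w)`, summed over all directed edges `v → w`; an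
undirected loop gives two directed edges. -/
def firing (v : V) : V →₀ k :=
  ∑ e ∈ (X.finite_src v).toFinset, (Finsupp.single v 1 - Finsupp.single (X.tgt e) 1) +
  ∑ e ∈ (X.finite_tgt v).toFinset, (Finsupp.single v 1 - Finsupp.single (X.src e) 1)

/-- The principal divisors, inside the group `Div(X) = (V →₀ k)` of divisors with coefficients
in `k`. -/
def principal : Submodule k (V →₀ k) := Submodule.span k (Set.range (X.firing k))

/-- The Picard group `Pic(X) = Div(X)/Pr(X)` with coefficients in `k`. -/
abbrev Pic : Type _ := (V →₀ k) ⧸ X.principal k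

end Divisors

section Derived

variable {V E A : Type*} [Group A] (X : Multigraph V E) (α : E → A)

/-- The derived graph of a voltage assignment `α`: its vertices are the pairs `(v, a)`, and an edge
`e` from `v` to `w` gives an edge from `(v, a)` to `(w, a α(e))` for every `a`. -/
def derived : Multigraph (V × A) (E × A) where
  src e := (X.src e.1, e.2)
  tgt e := (X.tgt e.1, e.2 * α e.1)
  finite_src := by
    rintro ⟨v, a⟩
    refine ((X.finite_src v).image fun e => (e, a)).subset ?_
    rintro ⟨e, b⟩ h
    simp only [Set.mem_ofPred_eq, Prod.mk.injEq] at h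
    exact ⟨e, h.1, by rw [h.2]⟩
  finite_tgt := by
    rintro ⟨v, a⟩
    refine ((X.finite_tgt v).image fun e => (e, a * (α e)⁻¹)).subset ?_
    rintro ⟨e, b⟩ h
    simp only [Set.mem_ofPred_eq, Prod.mk.injEq] at h
    exact ⟨e, h.1, by rw [← h.2]; simp⟩

variable (k : Type*) [CommRing k]

variable (V A) in
/-- The action `g (v, a) = (v, g a)` of `A` on divisors with vertex set `V × A`. -/
def divAction : Representation k A (V × A →₀ k) where
  toFun g := Finsupp.lmapDomain k k fun x => (x.1, g * x.2)
  map_one' := by ext; simp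
  map_mul' g h := by ext; simp [mul_assoc]

lemma divAction_firing (g : A) (x : V × A) :
    divAction V A k g ((X.derived α).firing k x) =
      (X.derived α).firing k (x.1, g * x.2) := by
  obtain ⟨v, a⟩ := x
  simp only [firing, map_add, map_sum, map_sub]
  congr 1
  · refine Finset.sum_bij' (fun e _ => (e.1, g * e.2)) (fun e _ => (e.1, g⁻¹ * e.2))
      ?_ ?_ ?_ ?_ ?_
    · rintro ⟨e, b⟩ h
      simp_all [derived]
    · rintro ⟨e, b⟩ h
      simp_all [derived]
    · rintro ⟨e, b⟩ h
      simp
    · rintro ⟨e, b⟩ h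
      simp
    · rintro ⟨e, b⟩ h
      simp [divAction, derived, mul_assoc]
  · refine Finset.sum_bij' (fun e _ => (e.1, g * e.2)) (fun e _ => (e.1, g⁻¹ * e.2))
      ?_ ?_ ?_ ?_ ?_
    · rintro ⟨e, b⟩ h
      simp_all [derived, mul_assoc]
    · rintro ⟨e, b⟩ h
      simp_all [derived, mul_assoc]
    · rintro ⟨e, b⟩ h
      simp
    · rintro ⟨e, b⟩ h
      simp
    · rintro ⟨e, b⟩ h
      simp [divAction, derived]

lemma principal_le_comap (g : A) :
    (X.derived α).principal k ≤ ((X.derived α).principal k).comap (divAction V A k g) := by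
  rw [principal, Submodule.span_le]
  rintro _ ⟨x, rfl⟩
  rw [SetLike.mem_coe, Submodule.mem_comap, divAction_firing]
  exact Submodule.subset_span ⟨_, rfl⟩

/-- The induced action of `A` on the Picard group of the derived graph. -/
def picAction : Representation k A ((X.derived α).Pic k) :=
  (divAction V A k).quotient ((X.derived α).principal k) (X.principal_le_comap α k)

/-- The Picard group of the derived graph as a module over the group ring `k[A]`. -/
instance picModule : Module (MonoidAlgebra k A) ((X.derived α).Pic k) :=
  Module.compHom _ (picAction X α k).asAlgebraHom.toRingHom

end Derived

/-- The `ℤ_p⟦G⟧`-module `ℤ_p⟦G⟧ ⊗_{ℤ_p[G]} Pic(X_∞)`, where `X_∞` is the derived graph of the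
voltage assignment `α` with values in the topological group `G`. -/
abbrev IwasawaPic {V E : Type*} (X : Multigraph V E) (p : ℕ) [Fact p.Prime] {G : Type*} [Group G]
    [TopologicalSpace G] (α : E → G) : Type _ :=
  ScalarExtension (toIwasawaAlgebra p G) ((X.derived α).Pic ℤ_[p])

end Multigraph

end VoltageCover

end

/-! Deck transformations multiply group elements on the left and edges multiply them on the right,
so a divisor becomes a row vector over the group ring on which the Laplacian `L` acts from the
right, compatibly with the left action. Hence `Pic_∞` is the cokernel of `L` on `Λ^V`, and `Pic_Y`
is the cokernel of its image over `Λ₁` (`generators_surjective`, `generators_vecMul`,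
`mem_range_of_generators_eq_zero`).

The ring `Λ₁` is commutative, so determinants are available there. The Laplacian is injective over
`Λ₁`: a harmonic divisor on a finite connected level is constant, and a compatible family of
constants in a tower of unbounded degree vanishes (`laplacian_injective`). Together with `μ = 0`
this forces `d = det L` to be prime to `p` (`not_natCast_dvd_det`), and `d` kills `Pic_Y`. Since
`Λ₁/p` behaves like `𝔽_p⟦T⟧` with `T = γ - 1`, some `T^j` lies in `(p, d)` at every finite level
(`exists_subOne_pow_eq`). So the elements `T^i e_v` with `i < j` span `Pic_Y/p` at each finite
level.

Nakayama's lemma transports this to `G`: dividing the module of a finite level by the augmentation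
ideal of the image of `H` and by `p` leaves a quotient that lives over `G/H`, so lifts of these `T^i
e_v` generate over `ℤ_p[H]` modulo `L` (`combination_surjective`). Compactness of the completed
group rings gives generation over `ℤ_p⟦H⟧` itself (`exists_eq_sum_add_vecMul`). The
`𝔐_H(G)`-property follows by passing to a quotient. -/

noncomputable section

namespace VoltageCover

open scoped TensorProduct Matrix

namespace Multigraph

/-! ### The Picard module as the cokernel of the Laplacian -/

section Laplacian

variable {V E A A' : Type*} [Fintype V] [DecidableEq V] [Fintype E] [Group A] [Group A']
  (X : Multigraph V E) (k : Type*) [CommRing k] (α : E → A)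

/-- The Laplacian of a voltage assignment, as a square matrix over the group ring; it acts on row
vectors from the right. -/
def laplacian : Matrix V V (MonoidAlgebra k A) := Matrix.of fun v =>
  ∑ e, ((if X.src e = v then
      Pi.single v 1 - Pi.single (X.tgt e) (MonoidAlgebra.single (α e) 1) else 0) +
    (if X.tgt e = v then
      Pi.single v 1 - Pi.single (X.src e) (MonoidAlgebra.single (α e)⁻¹ 1) else 0))

omit [Fintype V] in
lemma laplacian_map (f : A →* A') :
    (X.laplacian k α).map (MonoidAlgebra.mapDomainAlgHom k k f) = X.laplacian k (f ∘ α) := by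
  ext1 v w
  simp only [laplacian, Matrix.map_apply, Matrix.of_apply, Finset.sum_apply, map_sum, map_add,
    Pi.add_apply, apply_ite (fun h : V → MonoidAlgebra k A => h w),
    apply_ite (fun h : V → MonoidAlgebra k A' => h w), Pi.sub_apply, Pi.zero_apply, map_zero,
    apply_ite (MonoidAlgebra.mapDomainAlgHom k k f), map_sub, Pi.single_apply, map_one]
  simp [map_inv]

omit [Fintype V] in
lemma firing_derived (v : V) (a : A) : (X.derived α).firing k (v, a) =
    ∑ e, ((if X.src e = v then
      Finsupp.single (v, a) 1 - Finsupp.single (X.tgt e, a * α e) 1 else 0) +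
    (if X.tgt e = v then
      Finsupp.single (v, a) 1 - Finsupp.single (X.src e, a * (α e)⁻¹) 1 else 0)) := by
  rw [firing, Finset.sum_add_distrib, ← Finset.sum_filter, ← Finset.sum_filter]
  congr 1
  · refine (Finset.sum_bij (fun e _ => (e, a)) ?_ ?_ ?_ ?_).symm
    · intro e he; simpa [derived] using he
    · intro e _ e' _ h; simpa using h
    · rintro ⟨e, b⟩ h
      simp only [derived, Set.Finite.mem_toFinset, Set.mem_ofPred_eq, Prod.mk.injEq] at h
      exact ⟨e, by simpa using h.1, by rw [h.2]⟩
    · intro e _; rfl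
  · refine (Finset.sum_bij (fun e _ => (e, a * (α e)⁻¹)) ?_ ?_ ?_ ?_).symm
    · intro e he; simpa [derived] using he
    · intro e _ e' _ h; simpa using congrArg Prod.fst h
    · rintro ⟨e, b⟩ h
      simp only [derived, Set.Finite.mem_toFinset, Set.mem_ofPred_eq, Prod.mk.injEq] at h
      exact ⟨e, by simpa using h.1, by rw [← h.2]; simp⟩
    · intro e _; rfl

variable {k} {B : Type*} [Ring B] (f : MonoidAlgebra k A →+* B)

variable (V) in
/-- The image of a divisor under the coordinate map `(V × A →₀ k) → B^V` attached to a ring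
homomorphism `k[A] → B`. -/
def coords : (V × A →₀ k) →+ (V → B) :=
  Finsupp.liftAddHom fun x => (AddMonoidHom.single (fun _ : V => B) x.1).comp
    (f.toAddMonoidHom.comp (MonoidAlgebra.singleAddHom x.2))

omit [Fintype V] in
lemma coords_single (v : V) (a : A) (c : k) :
    coords V f (Finsupp.single (v, a) c) = Pi.single v (f (MonoidAlgebra.single a c)) := by
  simp [coords]

omit [Fintype V] in
lemma coords_divAction (a : A) (x : V × A →₀ k) :
    coords V f (divAction V A k a x) = f (MonoidAlgebra.single a 1) • coords V f x := by
  induction x using Finsupp.induction_linear with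
  | zero => simp
  | add x y hx hy => simp [hx, hy]
  | single x c =>
    obtain ⟨v, b⟩ := x
    simp [divAction, coords_single, ← Pi.single_smul, ← map_mul, MonoidAlgebra.single_mul_single]

omit [Fintype V] in
lemma coords_smul (c : k) (x : V × A →₀ k) :
    coords V f (c • x) = f (MonoidAlgebra.single 1 c) • coords V f x := by
  induction x using Finsupp.induction_linear with
  | zero => simp
  | add x y hx hy => simp [hx, hy]
  | single x c =>
    obtain ⟨v, b⟩ := x
    rw [Finsupp.smul_single, coords_single, coords_single, ← Pi.single_smul, smul_eq_mul,
      smul_eq_mul, ← map_mul, MonoidAlgebra.single_mul_single, one_mul]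

omit [Fintype V] in
lemma coords_firing_one (v : V) :
    coords V f ((X.derived α).firing k (v, 1)) = (X.laplacian k α).map f v := by
  ext w
  simp only [firing_derived, laplacian, Matrix.map_apply, Matrix.of_apply, Finset.sum_apply,
    map_sum, map_add, Pi.add_apply, one_mul]
  refine Finset.sum_congr rfl fun e _ => ?_
  congr 1 <;> split_ifs <;>
    simp [coords_single, Pi.single_apply, ← MonoidAlgebra.one_def, apply_ite f]

/-- Translation by `a` reduces to the firing move at `(v, 1)`, which is row `v` of the Laplacian; so
principal divisors have coordinates in the row space. -/
lemma coords_firing (v : V) (a : A) :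
    coords V f ((X.derived α).firing k (v, a)) =
      Pi.single v (f (MonoidAlgebra.single a 1)) ᵥ* (X.laplacian k α).map f := by
  have := X.divAction_firing α k a (v, 1)
  rw [mul_one] at this
  rw [← this, coords_divAction, coords_firing_one, Matrix.single_vecMul]
  rfl

/-- The map `B^V → B ⊗ Pic` sending basis vectors to the classes of the vertices `(v, 1)`. -/
def generators : (V → B) →ₗ[B] ScalarExtension f ((X.derived α).Pic k) where
  toFun z := ∑ v, Submodule.Quotient.mk
    (z v ⊗ₜ[ℤ] Submodule.Quotient.mk (Finsupp.single (v, (1 : A)) (1 : k)))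
  map_add' x y := by
    simp [TensorProduct.add_tmul, Finset.sum_add_distrib]
  map_smul' c x := by
    simp [Finset.smul_sum, ← Submodule.Quotient.mk_smul, TensorProduct.smul_tmul']

omit [Fintype V] [DecidableEq V] [Fintype E] in
lemma mk_tmul_smul {N : Type*} [AddCommGroup N] [Module (MonoidAlgebra k A) N] (b : B)
    (r : MonoidAlgebra k A) (n : N) :
    (Submodule.Quotient.mk (b ⊗ₜ[ℤ] (r • n)) : ScalarExtension f N) =
      Submodule.Quotient.mk ((b * f r) ⊗ₜ[ℤ] n) := by
  symm
  rw [Submodule.Quotient.eq]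
  exact Submodule.subset_span ⟨b, r, n, rfl⟩

omit [Fintype V] [DecidableEq V] [Fintype E] in
lemma single_smul_mk (a : A) (c : k) (x : V × A →₀ k) :
    MonoidAlgebra.single a c • (Submodule.Quotient.mk x : (X.derived α).Pic k) =
      Submodule.Quotient.mk (c • divAction V A k a x) := by
  change (picAction X α k).asAlgebraHom (MonoidAlgebra.single a c) (Submodule.Quotient.mk x) = _
  rw [Representation.asAlgebraHom_single]
  rfl

omit [Fintype E] in
lemma generators_single (v : V) (b : B) : X.generators α f (Pi.single v b) =
    Submodule.Quotient.mk
      (b ⊗ₜ[ℤ] Submodule.Quotient.mk (Finsupp.single (v, (1 : A)) (1 : k))) := by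
  simp only [generators, LinearMap.coe_mk, AddHom.coe_mk]
  rw [Finset.sum_eq_single v]
  · simp
  · intro w _ h; simp [Pi.single_eq_of_ne h]
  · simp

omit [Fintype E] in
lemma generators_coords (x : V × A →₀ k) : X.generators α f (coords V f x) =
    Submodule.Quotient.mk (1 ⊗ₜ[ℤ] Submodule.Quotient.mk x) := by
  induction x using Finsupp.induction_linear with
  | zero => simp
  | add x y hx hy => simp [hx, hy, TensorProduct.tmul_add]
  | single x c =>
    obtain ⟨v, a⟩ := x
    rw [coords_single, generators_single, ← one_mul (f _), ← mk_tmul_smul, single_smul_mk]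
    simp [divAction]

omit [Fintype E] in
lemma generators_surjective : Function.Surjective (X.generators α f) := by
  rw [← LinearMap.range_eq_top, eq_top_iff]
  rintro x -
  obtain ⟨x, rfl⟩ := Submodule.Quotient.mk_surjective _ x
  induction x using TensorProduct.induction_on with
  | zero => simp
  | add x y hx hy => exact add_mem hx hy
  | tmul b n =>
    obtain ⟨n, rfl⟩ := Submodule.Quotient.mk_surjective _ n
    refine ⟨b • coords V f n, ?_⟩
    rw [map_smul, generators_coords, ← Submodule.Quotient.mk_smul, TensorProduct.smul_tmul',
      smul_eq_mul, mul_one]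

lemma generators_vecMul (z : V → B) :
    X.generators α f (z ᵥ* (X.laplacian k α).map f) = 0 := by
  rw [Matrix.vecMul_eq_sum, map_sum]
  refine Finset.sum_eq_zero fun v _ => ?_
  rw [map_smul, ← coords_firing_one, generators_coords, (Submodule.Quotient.mk_eq_zero (principal k _)).2,
    TensorProduct.tmul_zero, Submodule.Quotient.mk_zero, smul_zero]
  exact Submodule.subset_span ⟨_, rfl⟩

/-- Taking coordinates modulo the row space `N` kills principal divisors and is compatible with `f`,
so it extends to a `B`-linear map on `B ⊗ Pic`. Composed with `generators` it is the quotient map by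
`N`, so the kernel of `generators` lies in `N`. -/
lemma mem_range_of_generators_eq_zero {z : V → B} (hz : X.generators α f z = 0) :
    ∃ y, y ᵥ* (X.laplacian k α).map f = z := by
  set L := (X.laplacian k α).map f with hL
  set N := LinearMap.range L.vecMulLinear with hN
  have hφ : ((X.derived α).principal k).toAddSubgroup ≤
      ((QuotientAddGroup.mk' N.toAddSubgroup).comp (coords V f)).ker := by
    intro x hx
    rw [AddMonoidHom.mem_ker]
    change QuotientAddGroup.mk _ = _
    rw [QuotientAddGroup.eq_zero_iff]
    change coords V f x ∈ N
    change x ∈ (X.derived α).principal k at hx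
    induction hx using Submodule.span_induction with
    | mem x hx =>
      obtain ⟨⟨v, a⟩, rfl⟩ := hx
      rw [coords_firing]
      exact ⟨_, rfl⟩
    | zero => simp
    | add x y _ _ hx hy => rw [map_add]; exact add_mem hx hy
    | smul c x _ hx => rw [coords_smul]; exact N.smul_mem _ hx
  let φ : (X.derived α).Pic k →+ (V → B) ⧸ N := QuotientAddGroup.lift _ _ hφ
  have hφmk (x) : φ (Submodule.Quotient.mk x) = Submodule.Quotient.mk (coords V f x) := rfl
  have hφsmul (r : MonoidAlgebra k A) (n) : φ (r • n) = f r • φ n := by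
    obtain ⟨x, rfl⟩ := Submodule.Quotient.mk_surjective _ n
    induction r using MonoidAlgebra.induction_linear with
    | zero => simp
    | add r s hr hs => rw [add_smul, map_add, hr, hs, map_add, add_smul]
    | single a c =>
      rw [single_smul_mk, hφmk, coords_smul, coords_divAction, smul_smul, ← map_mul,
        MonoidAlgebra.single_mul_single, one_mul, mul_one, hφmk, Submodule.Quotient.mk_smul]
  let ψ₀ : B ⊗[ℤ] (X.derived α).Pic k →+ (V → B) ⧸ N := TensorProduct.liftAddHom
    { toFun := fun b => (AddMonoidHom.comp (DistribSMul.toAddMonoidHom _ b) φ)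
      map_zero' := by ext; simp
      map_add' := fun b c => by ext; simp [add_smul] }
    (fun n b x => by
      change (n • b) • φ x = b • φ (n • x)
      rw [map_zsmul, smul_assoc, smul_comm])
  let ψ : B ⊗[ℤ] (X.derived α).Pic k →ₗ[B] (V → B) ⧸ N :=
    { ψ₀ with
      map_smul' := fun b x => by
        change ψ₀ (b • x) = b • ψ₀ x
        induction x using TensorProduct.induction_on with
        | zero => simp
        | add x y hx hy => rw [smul_add, map_add, hx, hy, map_add, smul_add]
        | tmul c n => exact mul_smul b c (φ n) }
  have hψt (b n) : ψ (b ⊗ₜ n) = b • φ n := rfl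
  have hψ : balancing f ((X.derived α).Pic k) ≤ LinearMap.ker ψ := by
    rw [balancing, Submodule.span_le]
    rintro _ ⟨b, r, n, rfl⟩
    rw [SetLike.mem_coe, LinearMap.mem_ker, map_sub, hψt, hψt, hφsmul, mul_smul, sub_self]
  have key : Submodule.liftQ _ ψ hψ ∘ₗ X.generators α f = N.mkQ := by
    refine LinearMap.pi_ext fun v b => ?_
    rw [LinearMap.comp_apply, generators_single, Submodule.liftQ_apply, hψt, hφmk, coords_single,
      ← MonoidAlgebra.one_def, map_one, ← Submodule.Quotient.mk_smul, ← Pi.single_smul,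
      smul_eq_mul, mul_one]
    rfl
  have : N.mkQ z = 0 := by rw [← key, LinearMap.comp_apply, hz, map_zero]
  rw [Submodule.mkQ_apply, Submodule.Quotient.mk_eq_zero] at this
  obtain ⟨y, hy⟩ := this
  exact ⟨y, hy⟩

end Laplacian

end Multigraph

namespace Multigraph

/-! ### Harmonic divisors on finite levels -/

section Harmonic

variable {V E A : Type*} [Fintype V] [DecidableEq V] [Fintype E] [Group A]
  (X : Multigraph V E) {k : Type*} [CommRing k] (α : E → A)

/-- The Laplacian grouped by edges: the difference of `z` along a lifted edge enters with sign `+`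
at its source and `-` at its target. This is the shape needed for summation by parts. -/
lemma vecMul_laplacian_apply (z : V → MonoidAlgebra k A) (w : V) (g : A) :
    ((z ᵥ* X.laplacian k α) w).coeff g =
      ∑ e, ((if X.src e = w then
          (z (X.src e)).coeff g - (z (X.tgt e)).coeff (g * α e) else 0) -
        (if X.tgt e = w then
          (z (X.src e)).coeff (g * (α e)⁻¹) - (z (X.tgt e)).coeff g else 0)) := by
  simp only [Matrix.vecMul, dotProduct, laplacian, Matrix.of_apply, Finset.sum_apply,
    Finset.mul_sum]
  rw [Finset.sum_comm]
  simp only [MonoidAlgebra.coeff_sum, Finsupp.coe_finsetSum, Finset.sum_apply]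
  refine Finset.sum_congr rfl fun e _ => ?_
  simp only [Pi.add_apply, mul_add, MonoidAlgebra.coeff_add, Finsupp.add_apply,
    Finset.sum_add_distrib]
  rw [Finset.sum_eq_single (X.src e) (fun b _ hb => by simp [hb.symm]) (by simp),
    Finset.sum_eq_single (X.tgt e) (fun b _ hb => by simp [hb.symm]) (by simp)]
  simp only [if_true, Pi.sub_apply, Pi.single_apply, mul_sub, MonoidAlgebra.coeff_sub,
    Finsupp.sub_apply, eq_comm (a := w)]
  by_cases h1 : X.src e = w <;> by_cases h2 : X.tgt e = w <;>
    simp [h1, h2, MonoidAlgebra.coeff_mul_single_apply] <;> ring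

/-- Green's formula: pairing `F` with its Laplacian gives the Dirichlet energy. The substitution `g
↦ g α(e)` matches the terms at the two ends of an edge. -/
lemma energy_eq [Fintype A] (F : V → A → ℚ) :
    ∑ w, ∑ g, F w g * ∑ e, ((if X.src e = w then
          F (X.src e) g - F (X.tgt e) (g * α e) else 0) -
        (if X.tgt e = w then
          F (X.src e) (g * (α e)⁻¹) - F (X.tgt e) g else 0)) =
      ∑ e, ∑ g, (F (X.src e) g - F (X.tgt e) (g * α e)) ^ 2 := by
  have (e : E) : ∑ g, (F (X.src e) g - F (X.tgt e) (g * α e)) ^ 2 =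
      ∑ g, (F (X.src e) g * (F (X.src e) g - F (X.tgt e) (g * α e)) -
        F (X.tgt e) g * (F (X.src e) (g * (α e)⁻¹) - F (X.tgt e) g)) := by
    rw [Finset.sum_sub_distrib, ← Equiv.sum_comp (Equiv.mulRight (α e)) (fun g => F (X.tgt e) g *
      (F (X.src e) (g * (α e)⁻¹) - F (X.tgt e) g)), ← Finset.sum_sub_distrib]
    refine Finset.sum_congr rfl fun g _ => ?_
    simp only [Equiv.coe_mulRight, mul_inv_cancel_right]
    ring
  simp only [this, Finset.mul_sum]
  rw [Finset.sum_comm]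
  conv_rhs => rw [Finset.sum_comm]
  refine Finset.sum_congr rfl fun g _ => ?_
  rw [Finset.sum_comm]
  refine Finset.sum_congr rfl fun e _ => ?_
  simp only [mul_sub, Finset.sum_sub_distrib, mul_ite, mul_zero]
  simp

/-- Vanishing of a sum of squares requires an ordered field, so the coefficients are first pushed
into `ℚ` by an additive map. -/
lemma eq_of_vecMul_laplacian_eq_zero [Finite A] (φ : k →+ ℚ) {z : V → MonoidAlgebra k A}
    (hz : z ᵥ* X.laplacian k α = 0) (e : E) (g : A) :
    φ ((z (X.src e)).coeff g) = φ ((z (X.tgt e)).coeff (g * α e)) := by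
  cases nonempty_fintype A
  have h := X.energy_eq α fun v a => φ ((z v).coeff a)
  have h0 : ∀ w g, ∑ e, ((if X.src e = w then
          φ ((z (X.src e)).coeff g) - φ ((z (X.tgt e)).coeff (g * α e)) else 0) -
        (if X.tgt e = w then
          φ ((z (X.src e)).coeff (g * (α e)⁻¹)) - φ ((z (X.tgt e)).coeff g) else 0)) = 0 := by
    intro w g
    have := congrArg φ (X.vecMul_laplacian_apply α z w g)
    rw [hz] at this
    simpa [apply_ite φ] using this.symm
  simp only [h0, mul_zero, Finset.sum_const_zero] at h
  have h1 := (Finset.sum_eq_zero_iff_of_nonneg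
    (fun e _ => Finset.sum_nonneg fun g _ => sq_nonneg _)).1 h.symm e (Finset.mem_univ e)
  have h2 := (Finset.sum_eq_zero_iff_of_nonneg (fun g _ => sq_nonneg _)).1 h1 g (Finset.mem_univ g)
  exact sub_eq_zero.1 (pow_eq_zero_iff two_ne_zero |>.1 h2)

/-- A harmonic divisor on a finite derived graph is locally constant. -/
lemma coeff_eq_of_vecMul_laplacian_eq_zero {p : ℕ} [Fact p.Prime] [Finite A]
    {z : V → MonoidAlgebra ℤ_[p] A} (hz : z ᵥ* X.laplacian ℤ_[p] α = 0) (e : E) (g : A) :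
    (z (X.src e)).coeff g = (z (X.tgt e)).coeff (g * α e) := by
  -- `ℚ_p` is a `ℚ`-vector space, so its `ℚ`-linear functionals separate points; no continuity is
  -- needed.
  rw [← sub_eq_zero, ← PadicInt.coe_eq_zero, ← Module.forall_dual_apply_eq_zero_iff ℚ]
  intro φ
  have := X.eq_of_vecMul_laplacian_eq_zero α
    (φ.toAddMonoidHom.comp (PadicInt.Coe.ringHom (p := p)).toAddMonoidHom) hz e g
  rw [PadicInt.coe_sub, map_sub]
  exact sub_eq_zero.2 this

omit [Fintype V] [DecidableEq V] [Fintype E] in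
lemma eq_of_connected {B T : Type*} [Group B] {β : E → B} (hβ : (X.derived β).Connected)
    {π : B →* A} (hπ : Function.Surjective π) (hα : ∀ e, π (β e) = α e) {F : V → A → T}
    (hF : ∀ e a, F (X.src e) a = F (X.tgt e) (a * α e)) (v w : V) (a b : A) : F v a = F w b := by
  obtain ⟨a, rfl⟩ := hπ a
  obtain ⟨b, rfl⟩ := hπ b
  have key := hβ.2 (v, a) (w, b)
  suffices ∀ x y : V × B, Relation.EqvGen
      (fun a b => ∃ e, (X.derived β).src e = a ∧ (X.derived β).tgt e = b) x y →
      F x.1 (π x.2) = F y.1 (π y.2) from this _ _ key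
  intro x y h
  induction h with
  | rel x y h =>
    obtain ⟨⟨e, c⟩, rfl, rfl⟩ := h
    simp [derived, hF, hα]
  | refl => rfl
  | symm _ _ _ h => exact h.symm
  | trans _ _ _ _ _ h1 h2 => exact h1.trans h2

end Harmonic

end Multigraph

/-! ### Finite levels of the completed group ring and injectivity of the Laplacian -/

section Levels

variable (p : ℕ) [Fact p.Prime] (K : Type*) [Group K] [TopologicalSpace K]

/-- The projection `ℤ_p⟦K⟧ → ℤ_p[K/U]`. -/
def IwasawaAlgebra.proj (U : OpenNormalSubgroup K) :
    IwasawaAlgebra p K →+* MonoidAlgebra ℤ_[p] (K ⧸ U.toSubgroup) where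
  toFun x := x.1 U
  map_one' := rfl
  map_mul' _ _ := rfl
  map_zero' := rfl
  map_add' _ _ := rfl

variable {K}

lemma IwasawaAlgebra.transition_proj {U W : OpenNormalSubgroup K} (h : U ≤ W)
    (x : IwasawaAlgebra p K) : transition p K h (proj p K U x) = proj p K W x :=
  x.2 U W h

variable {p} in
lemma IwasawaAlgebra.ext_proj {x y : IwasawaAlgebra p K} (h : ∀ U, proj p K U x = proj p K U y) :
    x = y :=
  Subtype.ext (funext h)

lemma IwasawaAlgebra.proj_toIwasawaAlgebra (U : OpenNormalSubgroup K) (x : MonoidAlgebra ℤ_[p] K) :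
    proj p K U (toIwasawaAlgebra p K x) =
      MonoidAlgebra.mapDomainAlgHom ℤ_[p] ℤ_[p] (QuotientGroup.mk' U.toSubgroup) x := rfl

variable {V E : Type*} [Fintype V] [DecidableEq V] [Fintype E]
  (X : Multigraph V E) (α : E → K)

lemma Multigraph.proj_vecMul_laplacian (U : OpenNormalSubgroup K) (z : V → IwasawaAlgebra p K) :
    IwasawaAlgebra.proj p K U ∘ (z ᵥ* (X.laplacian ℤ_[p] α).map (toIwasawaAlgebra p K)) =
      (IwasawaAlgebra.proj p K U ∘ z) ᵥ* X.laplacian ℤ_[p] fun e => (α e : K ⧸ U.toSubgroup) := by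
  ext1 w
  rw [Function.comp_apply, RingHom.map_vecMul, Matrix.map_map]
  have := X.laplacian_map ℤ_[p] α (QuotientGroup.mk' U.toSubgroup)
  change _ = ((IwasawaAlgebra.proj p K U ∘ z) ᵥ*
    X.laplacian ℤ_[p] (QuotientGroup.mk' U.toSubgroup ∘ α)) w
  rw [← this]
  rfl

/-- The augmentation of a group ring. -/
def augmentation (A : Type*) [Group A] : MonoidAlgebra ℤ_[p] A →ₐ[ℤ_[p]] ℤ_[p] :=
  MonoidAlgebra.lift ℤ_[p] ℤ_[p] A 1

lemma augmentation_apply {A : Type*} [Group A] [Fintype A] (x : MonoidAlgebra ℤ_[p] A) :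
    augmentation p A x = ∑ a, x.coeff a := by
  simp [augmentation, MonoidAlgebra.lift_apply, Finsupp.sum_fintype]

lemma augmentation_mapDomain {A B : Type*} [Group A] [Group B] (f : A →* B)
    (x : MonoidAlgebra ℤ_[p] A) :
    augmentation p B (MonoidAlgebra.mapDomainAlgHom ℤ_[p] ℤ_[p] f x) = augmentation p A x := by
  induction x using MonoidAlgebra.induction_linear with
  | zero => simp
  | add x y hx hy => simp only [map_add, hx, hy]
  | single a c => simp [augmentation]

/-- The Laplacian of an infinite tower of connected graphs is injective. -/
lemma Multigraph.laplacian_injective (hfin : ∀ U : OpenNormalSubgroup K, Finite (K ⧸ U.toSubgroup))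
    (hp : ∀ U : OpenNormalSubgroup K, IsPGroup p (K ⧸ U.toSubgroup))
    (hbig : ∀ (U : OpenNormalSubgroup K) (N : ℕ), ∃ W ≤ U, N ≤ Nat.card (K ⧸ W.toSubgroup))
    (hconst : ∀ (U : OpenNormalSubgroup K) (F : V → K ⧸ U.toSubgroup → ℤ_[p]),
      (∀ e a, F (X.src e) a = F (X.tgt e) (a * α e)) → ∀ v w a b, F v a = F w b)
    {z : V → IwasawaAlgebra p K}
    (hz : z ᵥ* (X.laplacian ℤ_[p] α).map (toIwasawaAlgebra p K) = 0) : z = 0 := by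
  ext1 v
  refine IwasawaAlgebra.ext_proj fun U => ?_
  have hc (W : OpenNormalSubgroup K) (a b) : (IwasawaAlgebra.proj p K W (z v)).coeff a =
      (IwasawaAlgebra.proj p K W (z v)).coeff b := by
    refine hconst W (fun v a => (IwasawaAlgebra.proj p K W (z v)).coeff a) ?_ v v a b
    have := hfin W
    refine X.coeff_eq_of_vecMul_laplacian_eq_zero (z := IwasawaAlgebra.proj p K W ∘ z) _ ?_
    rw [← proj_vecMul_laplacian, hz]
    ext1 w
    exact map_zero _
  -- All coefficients at level `W` are equal, so the augmentation is the group order times any one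
  -- of them.
  have haug (W : OpenNormalSubgroup K) (a) : augmentation p _ (IwasawaAlgebra.proj p K W (z v)) =
      Nat.card (K ⧸ W.toSubgroup) * (IwasawaAlgebra.proj p K W (z v)).coeff a := by
    have := hfin W
    cases nonempty_fintype (K ⧸ W.toSubgroup)
    rw [augmentation_apply, Finset.sum_congr rfl fun b _ => hc W b a]
    simp
  -- The augmentation does not change with the level, while the levels below `U` have orders
  -- divisible by arbitrarily high powers of `p`.
  have h0 : augmentation p _ (IwasawaAlgebra.proj p K U (z v)) = 0 := by
    rw [← norm_eq_zero]
    by_contra hne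
    have hpos : 0 < ‖augmentation p _ (IwasawaAlgebra.proj p K U (z v))‖ :=
      lt_of_le_of_ne (norm_nonneg _) (Ne.symm hne)
    obtain ⟨n, hn⟩ := PadicInt.exists_pow_neg_lt p hpos
    obtain ⟨W, hWU, hW⟩ := hbig U (p ^ n)
    have := hfin W
    obtain ⟨m, hm⟩ := IsPGroup.iff_card.1 (hp W)
    have hnm : n ≤ m := by
      rw [hm] at hW
      exact (Nat.pow_le_pow_iff_right (Fact.out (p := p.Prime)).one_lt).1 hW
    have h1 : augmentation p _ (IwasawaAlgebra.proj p K U (z v)) =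
        augmentation p _ (IwasawaAlgebra.proj p K W (z v)) := by
      rw [← IwasawaAlgebra.transition_proj p hWU]
      exact augmentation_mapDomain p _ _
    have h2 : (p : ℤ_[p]) ^ n ∣ augmentation p _ (IwasawaAlgebra.proj p K U (z v)) := by
      rw [h1, haug W 1, hm, Nat.cast_pow]
      exact (pow_dvd_pow _ hnm).mul_right _
    have h3 := (PadicInt.norm_le_pow_iff_mem_span_pow _ n).2 (Ideal.mem_span_singleton.2 h2)
    exact absurd hn (not_lt.2 h3)
  ext a
  have := hfin U
  rw [haug U a, mul_eq_zero, Nat.cast_eq_zero] at h0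
  simpa using h0.resolve_left Nat.card_pos.ne'

end Levels

/-! ### Group rings of cyclic groups and powers of `γ - 1` -/

section CyclicGroupRing

variable (k : Type*) [CommRing k] {Q : Type*} [Group Q]

/-- The element `γ - 1` of the group ring. -/
def subOne (γ : Q) : MonoidAlgebra k Q := MonoidAlgebra.single γ 1 - 1

lemma mapDomain_subOne {Q' : Type*} [Group Q'] (f : Q →* Q') (γ : Q) :
    MonoidAlgebra.mapDomainAlgHom k k f (subOne k γ) = subOne k (f γ) := by
  rw [subOne, map_sub, map_one]
  simp [subOne]

variable {k} {γ : Q} (hγ : ∀ x : Q, ∃ i : ℕ, x = γ ^ i)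

include hγ in
lemma commute_subOne (x : MonoidAlgebra k Q) : Commute (subOne k γ) x := by
  refine Commute.sub_left ?_ (Commute.one_left x)
  induction x using MonoidAlgebra.induction_linear with
  | zero => exact Commute.zero_right _
  | add x y hx hy => exact hx.add_right hy
  | single a c =>
    obtain ⟨i, rfl⟩ := hγ a
    simp [commute_iff_eq, MonoidAlgebra.single_mul_single, ← pow_succ, ← pow_succ']

include hγ in
lemma commute_of_generator (x y : MonoidAlgebra k Q) : Commute x y := by
  induction x using MonoidAlgebra.induction_linear with
  | zero => exact Commute.zero_left _
  | add x y hx hy => exact hx.add_left hy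
  | single a c =>
    induction y using MonoidAlgebra.induction_linear with
    | zero => exact Commute.zero_right _
    | add x y hx hy => exact hx.add_right hy
    | single b d =>
      obtain ⟨i, rfl⟩ := hγ a
      obtain ⟨j, rfl⟩ := hγ b
      simp [commute_iff_eq, MonoidAlgebra.single_mul_single, ← pow_add, add_comm, mul_comm]

include hγ in
lemma exists_eq_smul_one_add (x : MonoidAlgebra k Q) :
    ∃ (c : k) (y : MonoidAlgebra k Q), x = c • 1 + subOne k γ * y := by
  induction x using MonoidAlgebra.induction_linear with
  | zero => exact ⟨0, 0, by simp⟩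
  | add x y hx hy =>
    obtain ⟨c, x', hx⟩ := hx
    obtain ⟨d, y', hy⟩ := hy
    refine ⟨c + d, x' + y', ?_⟩
    rw [hx, hy, add_smul, mul_add]
    abel
  | single a c =>
    obtain ⟨i, rfl⟩ := hγ a
    obtain ⟨y, hy⟩ := sub_one_dvd_pow_sub_one (MonoidAlgebra.single γ (1 : k)) i
    refine ⟨c, c • y, ?_⟩
    rw [mul_smul_comm, subOne, ← hy, smul_sub, add_sub_cancel]
    simp [MonoidAlgebra.single_pow]

include hγ in
/-- Expansion in powers of `γ - 1`. -/
lemma exists_eq_sum_add (j : ℕ) (x : MonoidAlgebra k Q) :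
    ∃ (c : ℕ → k) (y : MonoidAlgebra k Q),
      x = ∑ i ∈ Finset.range j, c i • subOne k γ ^ i + subOne k γ ^ j * y := by
  induction j with
  | zero => exact ⟨0, x, by simp⟩
  | succ j ih =>
    obtain ⟨c, y, hy⟩ := ih
    obtain ⟨d, y', hy'⟩ := exists_eq_smul_one_add hγ y
    refine ⟨Function.update c j d, y', ?_⟩
    rw [Finset.sum_range_succ, Function.update_self, hy]
    have : ∀ i ∈ Finset.range j, Function.update c j d i • subOne k γ ^ i =
        c i • subOne k γ ^ i := fun i hi => by
      rw [Function.update_of_ne (Finset.mem_range.1 hi).ne]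
    rw [Finset.sum_congr rfl this, hy', mul_add, add_assoc, mul_smul_comm, mul_one, pow_succ,
      mul_assoc]

include hγ in
lemma card_eq_orderOf : orderOf γ = Nat.card Q :=
  orderOf_eq_card_of_forall_mem_zpowers fun x => by
    obtain ⟨i, rfl⟩ := hγ x
    exact ⟨i, by simp⟩

include hγ in
-- In the binomial expansion only the term `i = 0` contributes to the coefficient at `1`, because
-- `γ^i ≠ 1` for `0 < i ≤ m`; that coefficient is `±1`.
lemma subOne_pow_ne_zero [Nontrivial k] {m : ℕ} (hm : m < Nat.card Q) : subOne k γ ^ m ≠ 0 := by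
  classical
  intro h
  have hcomm : Commute (MonoidAlgebra.single γ (1 : k)) (-1) := (Commute.one_right _).neg_right
  rw [subOne, sub_eq_add_neg, hcomm.add_pow] at h
  have h1 := congrArg (fun x : MonoidAlgebra k Q => x.coeff 1) h
  simp only [MonoidAlgebra.coeff_sum, Finsupp.coe_finsetSum, Finset.sum_apply] at h1
  have hterm (i : ℕ) : ((MonoidAlgebra.single γ (1 : k)) ^ i * (-1) ^ (m - i) *
      ((m.choose i : ℕ) : MonoidAlgebra k Q)).coeff 1 =
      if γ ^ i = 1 then (-1) ^ (m - i) * (m.choose i : k) else 0 := by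
    have : (MonoidAlgebra.single γ (1 : k)) ^ i * (-1) ^ (m - i) *
      ((m.choose i : ℕ) : MonoidAlgebra k Q) =
        MonoidAlgebra.single (γ ^ i) ((-1) ^ (m - i) * (m.choose i : k)) := by
      have e1 : (-1 : MonoidAlgebra k Q) = MonoidAlgebra.single 1 (-1) := by
        rw [MonoidAlgebra.one_def, ← MonoidAlgebra.single_neg]
      rw [e1, MonoidAlgebra.natCast_def, MonoidAlgebra.single_pow, MonoidAlgebra.single_pow,
        MonoidAlgebra.single_mul_single, MonoidAlgebra.single_mul_single]
      simp
    rw [this, MonoidAlgebra.coeff_single, Finsupp.single_apply]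
  simp only [hterm] at h1
  rw [Finset.sum_eq_single 0] at h1
  · rcases neg_one_pow_eq_or k m with h2 | h2 <;> simp [h2] at h1
  · intro i hi h0
    rw [if_neg]
    intro hi1
    have := Nat.le_of_dvd (Nat.pos_of_ne_zero h0) (orderOf_dvd_of_pow_eq_one hi1)
    rw [card_eq_orderOf hγ] at this
    have := Finset.mem_range.1 hi
    omega
  · simp

/-- In characteristic `p`, `(γ - 1)^(p^n) = γ^(p^n) - 1`. -/
lemma subOne_pow_card [Finite Q] {p : ℕ} [Fact p.Prime] [CharP k p] (hQ : IsPGroup p Q) :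
    subOne k γ ^ Nat.card Q = 0 := by
  obtain ⟨n, hn⟩ := IsPGroup.iff_card.1 hQ
  have : CharP (MonoidAlgebra k Q) p := by
    refine charP_of_injective_algebraMap (R := k) ?_ p
    intro a b h
    simpa using congrArg (fun x : MonoidAlgebra k Q => x.coeff 1) h
  rw [subOne, hn, sub_pow_char_pow_of_commute p n (Commute.one_right _), ← hn]
  simp [MonoidAlgebra.single_pow, ← MonoidAlgebra.one_def]

end CyclicGroupRing

/-! ### Cyclic `p`-groups in characteristic `p`: every nonzero element is a power of `γ - 1` times a
unit -/

section CyclicGroupRingField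

variable {k : Type*} [Field k] {p : ℕ} [Fact p.Prime] [CharP k p] {Q : Type*} [Group Q] [Finite Q]
  (hQ : IsPGroup p Q) {γ : Q} (hγ : ∀ x : Q, ∃ i : ℕ, x = γ ^ i)

include hQ hγ in
lemma exists_eq_subOne_pow_mul_unit {x : MonoidAlgebra k Q} (hx : x ≠ 0) :
    ∃ (i : ℕ) (u : (MonoidAlgebra k Q)ˣ), i < Nat.card Q ∧ x = subOne k γ ^ i * u := by
  classical
  have h0 := subOne_pow_card (k := k) (γ := γ) hQ
  have hdvd : ∀ i, subOne k γ ^ i ∣ x → i < Nat.card Q := by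
    intro i hi
    by_contra hle
    refine hx (zero_dvd_iff.1 ?_)
    rw [← h0]
    exact (pow_dvd_pow _ (not_lt.1 hle)).trans hi
  set i := Nat.findGreatest (fun i => subOne k γ ^ i ∣ x) (Nat.card Q) with hi
  have hix : subOne k γ ^ i ∣ x :=
    Nat.findGreatest_spec (P := fun i => subOne k γ ^ i ∣ x) (Nat.zero_le _) (by simp)
  obtain ⟨y, hy⟩ := hix
  obtain ⟨c, z, hz⟩ := exists_eq_smul_one_add hγ y
  -- By maximality of `i`, the cofactor `y` is not divisible by `γ - 1`. It is then a nonzero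
  -- constant plus a nilpotent element, hence a unit.
  have hc : c ≠ 0 := by
    rintro rfl
    have hi1 : subOne k γ ^ (i + 1) ∣ x :=
      ⟨z, by rw [hy, hz, zero_smul, zero_add, pow_succ, mul_assoc]⟩
    have := Nat.le_findGreatest (P := fun i => subOne k γ ^ i ∣ x) (hdvd _ hi1).le hi1
    omega
  have hnil : IsNilpotent (subOne k γ * z) :=
    (commute_subOne hγ z).isNilpotent_mul_right ⟨_, h0⟩
  have hu : IsUnit (c • (1 : MonoidAlgebra k Q) + subOne k γ * z) := by
    refine hnil.isUnit_add_left_of_commute ?_ (commute_of_generator hγ _ _)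
    rw [← Algebra.algebraMap_eq_smul_one]
    exact (IsUnit.mk0 c hc).map _
  refine ⟨i, hu.unit, hdvd i ⟨y, hy⟩, ?_⟩
  rw [IsUnit.unit_spec, ← hz, hy]

end CyclicGroupRingField

/-! ### Reduction of group rings modulo `p` -/

section Reduction

variable (p : ℕ) [Fact p.Prime] (Q : Type*) [Group Q]

/-- Reduction modulo `p` of the coefficients in a group ring. -/
def reduction : MonoidAlgebra ℤ_[p] Q →+* MonoidAlgebra (ZMod p) Q :=
  MonoidAlgebra.mapRingHom Q PadicInt.toZMod

variable {p Q}

lemma toZMod_eq_zero_iff_dvd (x : ℤ_[p]) : PadicInt.toZMod x = 0 ↔ (p : ℤ_[p]) ∣ x := by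
  rw [← RingHom.mem_ker, PadicInt.ker_toZMod, PadicInt.maximalIdeal_eq_span_p,
    Ideal.mem_span_singleton]

lemma coeff_natCast_mul (n : ℕ) (x : MonoidAlgebra ℤ_[p] Q) (a : Q) :
    ((n : MonoidAlgebra ℤ_[p] Q) * x).coeff a = n * x.coeff a := by
  rw [← nsmul_eq_mul, MonoidAlgebra.coeff_smul, Finsupp.smul_apply, nsmul_eq_mul]

lemma reduction_eq_zero_iff [Finite Q] (x : MonoidAlgebra ℤ_[p] Q) :
    reduction p Q x = 0 ↔ (p : MonoidAlgebra ℤ_[p] Q) ∣ x := by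
  constructor
  · intro h
    have h1 (a) : ∃ c, x.coeff a = p * c := by
      have := congrArg (fun x : MonoidAlgebra (ZMod p) Q => x.coeff a) h
      rw [reduction] at this
      exact (toZMod_eq_zero_iff_dvd _).1 (by simpa using this)
    choose c hc using h1
    refine ⟨MonoidAlgebra.ofCoeff (Finsupp.equivFunOnFinite.symm c), ?_⟩
    ext a
    rw [coeff_natCast_mul, hc]
    rfl
  · rintro ⟨y, rfl⟩
    rw [map_mul, map_natCast]
    have : ((p : ℕ) : MonoidAlgebra (ZMod p) Q) = 0 := by
      rw [MonoidAlgebra.natCast_def]; simp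
    rw [this, zero_mul]

lemma reduction_surjective [Finite Q] : Function.Surjective (reduction p Q) := by
  intro y
  have h1 (a) := ZMod.ringHom_surjective (PadicInt.toZMod (p := p)) (y.coeff a)
  choose c hc using h1
  refine ⟨MonoidAlgebra.ofCoeff (Finsupp.equivFunOnFinite.symm c), ?_⟩
  ext a
  rw [reduction]
  simp [hc]

lemma reduction_mapDomain {Q' : Type*} [Group Q'] (f : Q →* Q') (x : MonoidAlgebra ℤ_[p] Q) :
    reduction p Q' (MonoidAlgebra.mapDomainAlgHom ℤ_[p] ℤ_[p] f x) =
      MonoidAlgebra.mapDomainAlgHom (ZMod p) (ZMod p) f (reduction p Q x) := by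
  induction x using MonoidAlgebra.induction_linear with
  | zero => simp
  | add x y hx hy => simp only [map_add, hx, hy]
  | single a c => simp [reduction]

lemma reduction_subOne (γ : Q) : reduction p Q (subOne ℤ_[p] γ) = subOne (ZMod p) γ := by
  simp [reduction, subOne]

end Reduction

/-! ### The prime `p` in the completed group ring of a procyclic pro-`p` group -/

section IwasawaReduction

variable {p : ℕ} [Fact p.Prime] {K : Type*} [Group K] [TopologicalSpace K]

lemma IwasawaAlgebra.natCast_mul_cancel {x y : IwasawaAlgebra p K}
    (h : (p : IwasawaAlgebra p K) * x = p * y) : x = y := by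
  refine ext_proj fun U => ?_
  have h1 := congrArg (proj p K U) h
  rw [map_mul, map_mul, map_natCast] at h1
  ext a
  have h2 := congrArg (fun x => x.coeff a) h1
  simp only [coeff_natCast_mul] at h2
  exact mul_left_cancel₀ (Nat.cast_ne_zero.2 (Fact.out (p := p.Prime)).ne_zero) h2

variable (hfin : ∀ U : OpenNormalSubgroup K, Finite (K ⧸ U.toSubgroup))

include hfin in
-- Divisibility can be tested at finite levels: the group rings have no `p`-torsion, so the
-- quotients by `p` are unique and automatically compatible.
lemma IwasawaAlgebra.natCast_dvd_iff (x : IwasawaAlgebra p K) :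
    (p : IwasawaAlgebra p K) ∣ x ↔ ∀ U, reduction p _ (proj p K U x) = 0 := by
  constructor
  · intro h U
    have := hfin U
    rw [reduction_eq_zero_iff, ← map_natCast (proj p K U)]
    exact map_dvd _ h
  · intro h
    have h1 (U) : (p : MonoidAlgebra ℤ_[p] (K ⧸ U.toSubgroup)) ∣ proj p K U x := by
      have := hfin U
      exact (reduction_eq_zero_iff _).1 (h U)
    choose y hy using h1
    have hcompat : ∀ (U W : OpenNormalSubgroup K) (h : U ≤ W), transition p K h (y U) = y W := by
      intro U W hUW
      have h2 := transition_proj p hUW x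
      rw [hy, hy, map_mul, map_natCast] at h2
      ext a
      have h3 := congrArg (fun x => x.coeff a) h2
      simp only [coeff_natCast_mul] at h3
      exact mul_left_cancel₀ (Nat.cast_ne_zero.2 (Fact.out (p := p.Prime)).ne_zero) h3
    refine ⟨⟨y, hcompat⟩, ext_proj fun U => ?_⟩
    rw [hy U, map_mul, map_natCast]
    rfl

lemma IwasawaAlgebra.eq_zero_of_forall_pow_dvd {x : IwasawaAlgebra p K}
    (h : ∀ n : ℕ, (p : IwasawaAlgebra p K) ^ n ∣ x) : x = 0 := by
  refine ext_proj fun U => ?_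
  ext a
  rw [map_zero, MonoidAlgebra.coeff_zero, Finsupp.zero_apply, ← norm_eq_zero]
  by_contra hne
  obtain ⟨n, hn⟩ := PadicInt.exists_pow_neg_lt p
    (lt_of_le_of_ne (norm_nonneg _) (Ne.symm hne))
  obtain ⟨y, rfl⟩ := h n
  refine absurd hn (not_lt.2 ((PadicInt.norm_le_pow_iff_mem_span_pow _ n).2
    (Ideal.mem_span_singleton.2 ⟨(proj p K U y).coeff a, ?_⟩)))
  rw [map_mul, map_pow, map_natCast, ← Nat.cast_pow, coeff_natCast_mul, Nat.cast_pow]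

variable (hp : ∀ U : OpenNormalSubgroup K, IsPGroup p (K ⧸ U.toSubgroup))
  {γ : K} (hγ : ∀ (U : OpenNormalSubgroup K) (x : K ⧸ U.toSubgroup), ∃ i : ℕ, x = (γ : K ⧸ _) ^ i)

include hγ in
lemma IwasawaAlgebra.mul_comm_of_generator (x y : IwasawaAlgebra p K) : x * y = y * x :=
  ext_proj fun U => by
    rw [map_mul, map_mul]
    exact commute_of_generator (hγ U) _ _

include hfin hp hγ in
/-- If the reduction of `d` is nonzero at some level `U`, then at every level below `U` it is a unit
times a power of `γ - 1`, the exponent being less than `[K : U]`. -/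
lemma IwasawaAlgebra.exists_reduction_proj_eq {d : IwasawaAlgebra p K} {U W : OpenNormalSubgroup K}
    (hWU : W ≤ U) (hd : reduction p _ (proj p K U d) ≠ 0) :
    ∃ (i : ℕ) (u : (MonoidAlgebra (ZMod p) (K ⧸ W.toSubgroup))ˣ), i < Nat.card (K ⧸ U.toSubgroup) ∧
      reduction p _ (proj p K W d) = subOne (ZMod p) (γ : K ⧸ W.toSubgroup) ^ i * u := by
  have := hfin U
  have := hfin W
  have hmap : MonoidAlgebra.mapDomainAlgHom (ZMod p) (ZMod p)
      (QuotientGroup.map W.toSubgroup U.toSubgroup (MonoidHom.id K) hWU)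
      (reduction p _ (proj p K W d)) = reduction p _ (proj p K U d) := by
    rw [← transition_proj p hWU, transition, reduction_mapDomain]
  have hne : reduction p _ (proj p K W d) ≠ 0 := by
    intro h
    rw [h, map_zero] at hmap
    exact hd hmap.symm
  obtain ⟨i, u, -, hu⟩ := exists_eq_subOne_pow_mul_unit (hp W) (hγ W) hne
  refine ⟨i, u, ?_, hu⟩
  -- An exponent `i ≥ [K : U]` would make the image at level `U` divisible by `(γ - 1)^[K : U] = 0`.
  by_contra hle
  refine hd ?_
  rw [← hmap, hu, map_mul, map_pow, mapDomain_subOne]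
  refine mul_eq_zero_of_left ?_ _
  rw [← Nat.add_sub_cancel' (not_lt.1 hle), pow_add]
  refine mul_eq_zero_of_left ?_ _
  exact subOne_pow_card (hp U)

include hfin hp hγ in
-- Modulo `p`, two nonzero elements have orders in `γ - 1` bounded independently of the level; at a
-- level of order at least the sum of the bounds, their product is still nonzero.
lemma IwasawaAlgebra.natCast_dvd_or_dvd
    (hbig : ∀ (U : OpenNormalSubgroup K) (N : ℕ), ∃ W ≤ U, N ≤ Nat.card (K ⧸ W.toSubgroup))
    {x y : IwasawaAlgebra p K} (hxy : (p : IwasawaAlgebra p K) ∣ x * y) :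
    (p : IwasawaAlgebra p K) ∣ x ∨ (p : IwasawaAlgebra p K) ∣ y := by
  by_contra! h
  simp only [natCast_dvd_iff hfin, not_forall] at h
  obtain ⟨⟨U, hU⟩, ⟨U', hU'⟩⟩ := h
  obtain ⟨W, hW, hcard⟩ := hbig (U ⊓ U')
    (Nat.card (K ⧸ U.toSubgroup) + Nat.card (K ⧸ U'.toSubgroup))
  obtain ⟨i, u, hi, hu⟩ := exists_reduction_proj_eq hfin hp hγ (hW.trans inf_le_left) hU
  obtain ⟨j, v, hj, hv⟩ := exists_reduction_proj_eq hfin hp hγ (hW.trans inf_le_right) hU'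
  have h0 := (natCast_dvd_iff hfin _).1 hxy W
  rw [map_mul, map_mul, hu, hv, mul_assoc, (commute_of_generator (hγ W) _ _).left_comm,
    Units.mul_right_eq_zero, ← mul_assoc, Units.mul_left_eq_zero, ← pow_add] at h0
  exact subOne_pow_ne_zero (hγ W) (by omega) h0

include hfin hp hγ in
/-- If `p` does not divide `d`, then some power of `γ - 1` lies in `(p, d)` at every finite
level. -/
lemma IwasawaAlgebra.exists_subOne_pow_eq {d : IwasawaAlgebra p K}
    (hd : ¬ (p : IwasawaAlgebra p K) ∣ d) : ∃ j : ℕ, ∀ U : OpenNormalSubgroup K,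
      ∃ a b : MonoidAlgebra ℤ_[p] (K ⧸ U.toSubgroup),
        subOne ℤ_[p] (γ : K ⧸ U.toSubgroup) ^ j = proj p K U d * a + p * b := by
  simp only [natCast_dvd_iff hfin, not_forall] at hd
  obtain ⟨U₀, hU₀⟩ := hd
  -- The order of the level `U₀` where `d` survives modulo `p` bounds its exponent at every level
  -- below `U₀`. For general `U` the relation is found at `U ⊓ U₀` and pushed forward.
  refine ⟨Nat.card (K ⧸ U₀.toSubgroup), fun U => ?_⟩
  have := hfin U
  have := hfin (U ⊓ U₀)
  obtain ⟨i, u, hi, hu⟩ := exists_reduction_proj_eq hfin hp hγ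
    (inf_le_right : U ⊓ U₀ ≤ U₀) hU₀
  obtain ⟨a, ha⟩ := reduction_surjective (p := p) ((↑u⁻¹ : MonoidAlgebra (ZMod p) _) *
    subOne (ZMod p) (γ : K ⧸ (U ⊓ U₀).toSubgroup) ^ (Nat.card (K ⧸ U₀.toSubgroup) - i))
  have h0 : reduction p _ (subOne ℤ_[p] (γ : K ⧸ (U ⊓ U₀).toSubgroup) ^
      Nat.card (K ⧸ U₀.toSubgroup) - proj p K (U ⊓ U₀) d * a) = 0 := by
    rw [map_sub, map_mul, hu, ha, mul_assoc, Units.mul_inv_cancel_left, ← pow_add,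
      Nat.add_sub_cancel' hi.le, map_pow, reduction_subOne, sub_self]
  obtain ⟨b, hb⟩ := (reduction_eq_zero_iff _).1 h0
  refine ⟨transition p K inf_le_left a, transition p K inf_le_left b, ?_⟩
  have := congrArg (transition p K (inf_le_left : U ⊓ U₀ ≤ U)) (sub_eq_iff_eq_add'.1 hb)
  rw [map_add, map_mul, map_mul, transition_proj, map_natCast, map_pow] at this
  rw [← this]
  congr 1
  exact (mapDomain_subOne ℤ_[p] (QuotientGroup.map (U ⊓ U₀).toSubgroup U.toSubgroup
    (MonoidHom.id K) inf_le_left) (γ : K ⧸ (U ⊓ U₀).toSubgroup)).symm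

end IwasawaReduction

/-! ### Consequences of a vanishing `μ`-invariant -/

section MuInvariant

variable {p : ℕ} {R : Type*} [Ring R] {M : Type*} [AddCommGroup M] [Module R M]

/-- If the `μ`-invariant vanishes, then every graded piece is torsion modulo `p`. -/
lemma exists_smul_eq_of_muInvariant_eq_zero (hμ : muInvariant p R M = 0) (i : ℕ) {y : M}
    (hy : y ∈ pPrimary p R M) :
    ∃ (f : R) (z : M), f ∉ Ideal.span {(p : R)} ∧ z ∈ pPrimary p R M ∧
      f • p ^ i • y = p ^ (i + 1) • z := by
  -- Summability rules out that the infinite sum is zero merely as a default value; in `ℕ∞` it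
  -- always holds.
  have hsum : Summable fun i : ℕ =>
      Cardinal.toENat (Module.rank (R ⧸ Ideal.span {(p : R)}) (gradedPiece p R M i)) :=
    ⟨_, hasSum_of_isLUB _ (isLUB_sSup _)⟩
  have h := hsum.tsum_eq_zero_iff.1 hμ i
  rw [Cardinal.toENat_eq_zero, rank_eq_zero_iff] at h
  obtain ⟨a, ha, hax⟩ := h (Submodule.Quotient.mk ⟨p ^ i • y, y, hy, rfl⟩)
  obtain ⟨f, rfl⟩ := Ideal.Quotient.mk_surjective a
  rw [Module.IsTorsionBySet.mk_smul, ← Submodule.Quotient.mk_smul,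
    Submodule.Quotient.mk_eq_zero] at hax
  obtain ⟨z, hz, hzf⟩ := hax
  refine ⟨f, z, fun hf => ha ?_, hz, ?_⟩
  · rwa [Ideal.Quotient.eq_zero_iff_mem]
  · exact hzf.symm

end MuInvariant

/-! ### The determinant of the Laplacian is prime to `p` -/

section Determinant

variable {V : Type*} [Fintype V] [DecidableEq V] {p : ℕ}

/-- A square matrix with injective action whose cokernel has vanishing `μ`-invariant has determinant
prime to `p`. -/
lemma not_natCast_dvd_det {R : Type*} [CommRing R] {M : Type*} [AddCommGroup M] [Module R M]
    (hprime : ∀ x y : R, (p : R) ∣ x * y → (p : R) ∣ x ∨ (p : R) ∣ y) (hone : ¬ (p : R) ∣ 1)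
    (hcancel : ∀ x y : R, p * x = p * y → x = y)
    (hsep : ∀ x : R, (∀ n : ℕ, (p : R) ^ n ∣ x) → x = 0)
    (L : Matrix V V R) (hL : ∀ z, z ᵥ* L = 0 → z = 0) (π : (V → R) →ₗ[R] M)
    (hsurj : Function.Surjective π) (hker : ∀ z, π z = 0 ↔ ∃ y, y ᵥ* L = z)
    (hμ : muInvariant p R M = 0) : ¬ (p : R) ∣ L.det := by
  intro hdvd
  have hfac : ∀ x : R, x ≠ 0 → ∃ (n : ℕ) (x' : R), x = p ^ n * x' ∧ ¬ (p : R) ∣ x' := by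
    classical
    intro x hx
    have hex : ∃ n : ℕ, ¬ (p : R) ^ n ∣ x := by
      by_contra! h
      exact hx (hsep x h)
    obtain ⟨n, hn⟩ : ∃ n, Nat.find hex = n + 1 :=
      Nat.exists_eq_succ_of_ne_zero fun h0 => by simpa [h0] using Nat.find_spec hex
    obtain ⟨x', hx'⟩ : (p : R) ^ n ∣ x := by
      by_contra h
      have := Nat.find_min' hex h
      omega
    refine ⟨n, x', hx', fun ⟨c, hc⟩ => ?_⟩
    have h1 := Nat.find_spec hex
    rw [hn] at h1
    exact h1 ⟨c, by rw [hx', hc, pow_succ, mul_assoc]⟩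
  have hpow : ∀ (n : ℕ) (x : R), (p : R) ^ n * x = 0 → x = 0 := by
    intro n
    induction n with
    | zero => simp
    | succ n ih =>
      intro x hx
      refine ih x (hcancel _ 0 ?_)
      rw [← mul_assoc, ← pow_succ', hx, mul_zero]
  have hne : (0 : R) ≠ 1 := fun h => hone (h ▸ dvd_zero _)
  have : Nontrivial R := ⟨⟨0, 1, hne⟩⟩
  -- Nonzero elements are powers of `p` times elements prime to `p`, and products of the latter stay
  -- prime to `p`.
  have : NoZeroDivisors R := by
    refine ⟨fun {x y} hxy => ?_⟩
    by_contra! h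
    obtain ⟨m, x', rfl, hx'⟩ := hfac x h.1
    obtain ⟨n, y', rfl, hy'⟩ := hfac y h.2
    have : x' * y' = 0 := by
      refine hpow (m + n) _ ?_
      rw [← hxy]
      ring
    exact (hprime x' y' (this ▸ dvd_zero _)).elim hx' hy'
  have : IsDomain R := NoZeroDivisors.to_isDomain R
  have hdet : L.det ≠ 0 := fun h => by
    obtain ⟨v, hv0, hv⟩ := Matrix.exists_vecMul_eq_zero_iff.2 h
    exact hv0 (hL v hv)
  let I : Ideal R := Ideal.span {(p : R)}
  have hI : ∀ x, x ∈ I ↔ (p : R) ∣ x := fun x => Ideal.mem_span_singleton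
  have hIprime : I.IsPrime := by
    refine ⟨fun h => hone ((hI 1).1 (h ▸ trivial)), fun {x y} hxy => ?_⟩
    rw [hI] at hxy ⊢
    rw [hI]
    exact hprime x y hxy
  have hdetI : (L.map (Ideal.Quotient.mk I)).det = 0 := by
    have := RingHom.map_det (Ideal.Quotient.mk I) L
    rw [RingHom.mapMatrix_apply] at this
    rw [← this, Ideal.Quotient.eq_zero_iff_mem, hI]
    exact hdvd
  -- If `p ∣ det L`, then `L` is singular over the domain `R/p`. A kernel vector lifts to `u` with
  -- `u L = p w`, so the class of `w` is killed by `p`.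
  obtain ⟨ubar, hu0, hu⟩ := Matrix.exists_vecMul_eq_zero_iff.2 hdetI
  choose u hub using fun v => Ideal.Quotient.mk_surjective (ubar v)
  obtain rfl : Ideal.Quotient.mk I ∘ u = ubar := funext hub
  have huL (v) : (p : R) ∣ (u ᵥ* L) v := by
    rw [← hI, ← Ideal.Quotient.eq_zero_iff_mem, RingHom.map_vecMul]
    exact congrFun hu v
  choose w hw using huL
  have huw : u ᵥ* L = (p : R) • w := funext hw
  have hx : π w ∈ pPrimary p R M := by
    refine ⟨1, ?_⟩
    rw [pow_one, ← Nat.cast_smul_eq_nsmul R, ← map_smul, hker]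
    exact ⟨u, huw⟩
  -- Each graded piece is torsion over `R/p`, so up to a multiplier prime to `p` the class of `w`
  -- becomes divisible by every power of `p`.
  have hchain : ∀ i : ℕ, ∃ (f : R) (y : M), ¬ (p : R) ∣ f ∧ y ∈ pPrimary p R M ∧
      f • π w = p ^ i • y := by
    intro i
    induction i with
    | zero => exact ⟨1, π w, hone, hx, by simp⟩
    | succ i ih =>
      obtain ⟨f, y, hf, hy, hfy⟩ := ih
      obtain ⟨g, z, hg, hz, hgz⟩ := exists_smul_eq_of_muInvariant_eq_zero hμ i hy
      refine ⟨g * f, z, fun h => ?_, hz, by rw [mul_smul, hfy, hgz]⟩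
      exact (hprime g f h).elim (fun h => hg ((hI g).2 h)) hf
  obtain ⟨a, d, had, hd⟩ := hfac L.det hdet
  obtain ⟨f, y, hf, -, hfy⟩ := hchain a
  obtain ⟨y, rfl⟩ := hsurj y
  -- With `det L = p^a d` and `f π(w) = p^a y`, one has `d f π(w) = det L · y`, which vanishes by
  -- the adjugate identity.
  have h0 : π ((d * f) • w) = 0 := by
    rw [map_smul, mul_smul, hfy, ← Nat.cast_smul_eq_nsmul R, smul_smul, mul_comm, Nat.cast_pow,
      ← had, ← map_smul, hker]
    exact ⟨y ᵥ* L.adjugate, by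
      rw [Matrix.vecMul_vecMul, Matrix.adjugate_mul, Matrix.vecMul_smul, Matrix.vecMul_one]⟩
  obtain ⟨s, hs⟩ := (hker _).1 h0
  -- Both vectors have the same image `p d f w` under `L`. Hence `p` divides `d f u`, so it divides
  -- `u`, against the choice of `ubar`.
  have h1 : (d * f) • u - (p : R) • s = 0 := by
    apply hL
    rw [Matrix.sub_vecMul, Matrix.smul_vecMul, Matrix.smul_vecMul, huw, hs, smul_comm, sub_self]
  refine hu0 (funext fun v => ?_)
  rw [Function.comp_apply, Pi.zero_apply, Ideal.Quotient.eq_zero_iff_mem, hI]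
  have h2 : (p : R) ∣ d * f * u v := ⟨s v, by simpa [sub_eq_zero] using congrFun h1 v⟩
  exact (hprime _ _ h2).resolve_left fun h => (hprime _ _ h).elim hd hf

/-- The completed group ring carries only a `Ring` structure; commutativity enters as a hypothesis
so that `d` can be taken to be the determinant. -/
lemma exists_vecMul_eq_single {R : Type*} [Ring R] (hcomm : ∀ x y : R, x * y = y * x)
    {M : Type*} [AddCommGroup M] [Module R M]
    (hprime : ∀ x y : R, (p : R) ∣ x * y → (p : R) ∣ x ∨ (p : R) ∣ y) (hone : ¬ (p : R) ∣ 1)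
    (hcancel : ∀ x y : R, p * x = p * y → x = y)
    (hsep : ∀ x : R, (∀ n : ℕ, (p : R) ^ n ∣ x) → x = 0)
    (L : Matrix V V R) (hL : ∀ z, z ᵥ* L = 0 → z = 0) (π : (V → R) →ₗ[R] M)
    (hsurj : Function.Surjective π) (hker : ∀ z, π z = 0 ↔ ∃ y, y ᵥ* L = z)
    (hμ : muInvariant p R M = 0) :
    ∃ d : R, ¬ (p : R) ∣ d ∧ ∀ v, ∃ y, y ᵥ* L = Pi.single v d := by
  let _ : CommRing R := { ‹Ring R› with mul_comm := hcomm }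
  refine ⟨L.det, not_natCast_dvd_det hprime hone hcancel hsep L hL π hsurj hker hμ, fun v => ?_⟩
  refine ⟨Pi.single v 1 ᵥ* L.adjugate, ?_⟩
  rw [Matrix.vecMul_vecMul, Matrix.adjugate_mul, Matrix.vecMul_smul, Matrix.vecMul_one,
    ← Pi.single_smul, smul_eq_mul, mul_one]

end Determinant

/-! ### Nakayama's lemma for `p`-groups -/

section Nakayama

variable {p : ℕ} [Fact p.Prime]

instance finite_residueField : Finite (IsLocalRing.ResidueField ℤ_[p]) :=
  Finite.of_equiv _ (PadicInt.residueField (p := p)).symm.toEquiv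

lemma residueField_smul_eq_zero (x : IsLocalRing.ResidueField ℤ_[p]) : (p : ℤ_[p]) • x = 0 := by
  rw [Algebra.smul_def]
  refine mul_eq_zero_of_left ?_ _
  rw [IsLocalRing.ResidueField.algebraMap_eq, IsLocalRing.residue_eq_zero_iff,
    PadicInt.maximalIdeal_eq_span_p]
  exact Ideal.mem_span_singleton_self _

/-- A proper submodule of a finitely generated module over a local ring is killed by a nonzero
functional with values in the residue field. -/
lemma exists_functional_ne_zero {R A : Type*} [CommRing R] [IsLocalRing R] [AddCommGroup A]
    [Module R A] [Module.Finite R A] {B : Submodule R A} (hB : B ≠ ⊤) :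
    ∃ f : A →ₗ[R] IsLocalRing.ResidueField R, f ≠ 0 ∧ ∀ b ∈ B, f b = 0 := by
  obtain ⟨N, hN, hBN⟩ := (eq_top_or_exists_le_coatom B).resolve_left hB
  have : IsSimpleModule R (A ⧸ N) := isSimpleModule_iff_isCoatom.2 hN
  obtain ⟨I, hI, ⟨e⟩⟩ := isSimpleModule_iff_quot_maximal.1 this
  obtain rfl := IsLocalRing.eq_maximalIdeal hI
  refine ⟨e.toLinearMap ∘ₗ N.mkQ, fun h => hN.1 ?_, fun b hb => ?_⟩
  · rw [eq_top_iff]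
    intro x _
    have h1 : e (N.mkQ x) = 0 := LinearMap.congr_fun h x
    rwa [LinearEquiv.map_eq_zero_iff, Submodule.mkQ_apply, Submodule.Quotient.mk_eq_zero] at h1
  · have : N.mkQ b = 0 := (Submodule.Quotient.mk_eq_zero _).2 (hBN hb)
    change e (N.mkQ b) = 0
    rw [this, map_zero]

/-- Nakayama's lemma for the action of a `p`-group, in dual form. -/
lemma eq_top_of_forall_invariant_functional {P A : Type*} [Group P] (hP : IsPGroup p P)
    [AddCommGroup A] [Module ℤ_[p] A] [Module.Finite ℤ_[p] A] (ρ : Representation ℤ_[p] P A)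
    (B : Submodule ℤ_[p] A) (hB : ∀ q, ∀ b ∈ B, ρ q b ∈ B)
    (h : ∀ f : A →ₗ[ℤ_[p]] IsLocalRing.ResidueField ℤ_[p],
      (∀ q x, f (ρ q x) = f x) → (∀ b ∈ B, f b = 0) → f = 0) : B = ⊤ := by
  by_contra hne
  let D : Submodule ℤ_[p] (A →ₗ[ℤ_[p]] IsLocalRing.ResidueField ℤ_[p]) :=
    { carrier := {f | ∀ b ∈ B, f b = 0}
      zero_mem' := fun b _ => rfl
      add_mem' := fun {f g} hf hg b hb => by simp [hf b hb, hg b hb]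
      smul_mem' := fun c f hf b hb => by simp [hf b hb] }
  have hfinA : Finite (A →ₗ[ℤ_[p]] IsLocalRing.ResidueField ℤ_[p]) := by
    obtain ⟨n, s, hs⟩ := Module.Finite.exists_fin (R := ℤ_[p]) (M := A)
    refine Finite.of_injective (fun f : A →ₗ[ℤ_[p]] IsLocalRing.ResidueField ℤ_[p] =>
      fun i => f (s i)) fun f g hfg => ?_
    refine LinearMap.ext_on_range hs fun i => congrFun hfg i
  let act : MulAction P D :=
    { smul := fun q f => ⟨f.1 ∘ₗ ρ q⁻¹, fun b hb => f.2 _ (hB _ _ hb)⟩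
      one_smul := fun f => Subtype.ext (LinearMap.ext fun x => by
        change f.1 (ρ 1⁻¹ x) = f.1 x
        simp)
      mul_smul := fun q r f => Subtype.ext (LinearMap.ext fun x => by
        change f.1 (ρ (q * r)⁻¹ x) = f.1 (ρ r⁻¹ (ρ q⁻¹ x))
        rw [mul_inv_rev, map_mul]
        rfl) }
  have hsmul (q : P) (f : D) (x : A) : (q • f).1 x = f.1 (ρ q⁻¹ x) := rfl
  obtain ⟨f₀, hf₀, hf₀B⟩ := exists_functional_ne_zero hne
  -- `D`, the residue-field dual of `A/B`, is finite, nonzero and killed by `p`. The number of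
  -- points fixed by the `p`-group is therefore divisible by `p`, so zero is not the only invariant
  -- functional.
  have hdvd : p ∣ Nat.card D := by
    let g : D := ⟨f₀, hf₀B⟩
    have hg : addOrderOf g = p := by
      refine addOrderOf_eq_prime ?_ fun h => hf₀ (congrArg Subtype.val h)
      refine Subtype.ext (LinearMap.ext fun x => ?_)
      change p • f₀ x = 0
      rw [← Nat.cast_smul_eq_nsmul ℤ_[p], residueField_smul_eq_zero]
    exact hg.symm.dvd.trans (addOrderOf_dvd_natCard g)
  have hz : (0 : D) ∈ MulAction.fixedPoints P D := fun q => Subtype.ext (LinearMap.ext fun x => rfl)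
  obtain ⟨f, hf, hf0⟩ := hP.exists_fixed_point_of_prime_dvd_card_of_fixed_point D hdvd hz
  refine hf0 (Subtype.ext (h f.1 (fun q x => ?_) f.2).symm)
  have := LinearMap.congr_fun (congrArg Subtype.val (hf q⁻¹)) x
  rw [hsmul, inv_inv] at this
  exact this

end Nakayama

/-! ### Generation over the group ring of `H` at a finite level -/

section Level

variable {p : ℕ} [Fact p.Prime] {V E Q Q' P : Type*} [Fintype V] [DecidableEq V] [Fintype E]
  [Group Q] [Group Q'] [Group P] (X : Multigraph V E) (α : E → Q)

variable (p V) in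
/-- Left multiplication on tuples of elements of the group ring. -/
def leftMul : Representation ℤ_[p] Q (V → MonoidAlgebra ℤ_[p] Q) where
  toFun q :=
    { toFun := fun z => MonoidAlgebra.single q (1 : ℤ_[p]) • z
      map_add' := fun x y => smul_add _ _ _
      map_smul' := fun c x => smul_comm _ _ _ }
  map_one' := by
    refine LinearMap.ext fun x => ?_
    change MonoidAlgebra.single (1 : Q) (1 : ℤ_[p]) • x = x
    rw [← MonoidAlgebra.one_def, one_smul]
  map_mul' q r := by
    refine LinearMap.ext fun x => ?_
    change MonoidAlgebra.single (q * r) (1 : ℤ_[p]) • x =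
      MonoidAlgebra.single q (1 : ℤ_[p]) • MonoidAlgebra.single r (1 : ℤ_[p]) • x
    rw [smul_smul, MonoidAlgebra.single_mul_single, one_mul]

/-- The map `(c, z) ↦ ∑ c_{v,i} (γ - 1)^i e_v + z L`. -/
def combination (ι : P →* Q) (γ : Q) (j : ℕ) :
    ((V → Fin j → MonoidAlgebra ℤ_[p] P) × (V → MonoidAlgebra ℤ_[p] Q)) →ₗ[ℤ_[p]]
      (V → MonoidAlgebra ℤ_[p] Q) where
  toFun x := (fun v => ∑ i, MonoidAlgebra.mapDomainAlgHom ℤ_[p] ℤ_[p] ι (x.1 v i) *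
    subOne ℤ_[p] γ ^ (i : ℕ)) + x.2 ᵥ* X.laplacian ℤ_[p] α
  map_add' x y := by
    rw [Prod.snd_add, Matrix.add_vecMul, add_add_add_comm]
    congr 1
    ext1 v
    simp only [Prod.fst_add, Pi.add_apply, map_add, add_mul, Finset.sum_add_distrib]
  map_smul' c x := by
    rw [Prod.smul_snd, Matrix.smul_vecMul, RingHom.id_apply, smul_add]
    congr 1
    ext1 v
    simp only [Prod.smul_fst, Pi.smul_apply, map_smul, smul_mul_assoc, Finset.smul_sum]

lemma combination_apply (ι : P →* Q) (γ : Q) (j : ℕ) (c : V → Fin j → MonoidAlgebra ℤ_[p] P)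
    (z : V → MonoidAlgebra ℤ_[p] Q) : combination X α ι γ j (c, z) =
      (fun v => ∑ i, MonoidAlgebra.mapDomainAlgHom ℤ_[p] ℤ_[p] ι (c v i) *
        subOne ℤ_[p] γ ^ (i : ℕ)) + z ᵥ* X.laplacian ℤ_[p] α := rfl

lemma mapDomain_surjective {π : Q →* Q'} (hπ : Function.Surjective π) :
    Function.Surjective (MonoidAlgebra.mapDomainAlgHom ℤ_[p] ℤ_[p] π) := by
  intro x
  induction x using MonoidAlgebra.induction_linear with
  | zero => exact ⟨0, map_zero _⟩
  | add x y hx hy =>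
    obtain ⟨x, rfl⟩ := hx
    obtain ⟨y, rfl⟩ := hy
    exact ⟨x + y, map_add _ _ _⟩
  | single x c =>
    obtain ⟨x, rfl⟩ := hπ x
    exact ⟨MonoidAlgebra.single x c, by simp⟩

/-- By Nakayama it suffices to kill every functional `f` into the residue field that is invariant
under the image of `P` and zero on the range. Invariance makes `f` factor through `Q'`, where `(γ -
1)^j ∈ (d, p)` and `d` kills the cokernel. -/
lemma combination_surjective [Finite Q] (hQ : IsPGroup p Q) {ι : P →* Q} {π : Q →* Q'}
    (hπ : Function.Surjective π) (hfib : ∀ x y, π x = π y → ∃ h, x = ι h * y) {γ : Q} {j : ℕ}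
    (hγ : ∀ x : Q', ∃ i : ℕ, x = π γ ^ i) {d a b : MonoidAlgebra ℤ_[p] Q'}
    (hd : subOne ℤ_[p] (π γ) ^ j = d * a + p * b)
    (hL : ∀ v, ∃ y, y ᵥ* X.laplacian ℤ_[p] (π ∘ α) = Pi.single v d) :
    Function.Surjective (combination (p := p) X α ι γ j) := by
  have : Finite Q' := Finite.of_surjective π hπ
  cases nonempty_fintype Q'
  rw [← LinearMap.range_eq_top]
  refine eq_top_of_forall_invariant_functional (P := ι.range) (hQ.to_subgroup _)
    ((leftMul p V).comp ι.range.subtype) _ ?_ ?_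
  · rintro ⟨_, h, rfl⟩ _ ⟨⟨c, z⟩, rfl⟩
    refine ⟨(fun v i => MonoidAlgebra.single h 1 * c v i,
      MonoidAlgebra.single (ι h) (1 : ℤ_[p]) • z), ?_⟩
    change _ = MonoidAlgebra.single (ι h) (1 : ℤ_[p]) • combination X α ι γ j (c, z)
    rw [combination_apply, combination_apply, smul_add, Matrix.smul_vecMul]
    congr 1
    ext1 v
    simp only [Pi.smul_apply, smul_eq_mul, Finset.mul_sum, map_mul, mul_assoc]
    simp
  · intro f hinv hzero
    have hfL (z) : f (z ᵥ* X.laplacian ℤ_[p] α) = 0 := by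
      refine hzero _ ⟨(0, z), ?_⟩
      rw [combination_apply]
      simp only [Pi.zero_apply, map_zero, zero_mul, Finset.sum_const_zero]
      exact zero_add _
    have hfT (v) (i) (hi : i < j) : f (Pi.single v (subOne ℤ_[p] γ ^ i)) = 0 := by
      refine hzero _ ⟨(Pi.single v (Pi.single ⟨i, hi⟩ 1), 0), ?_⟩
      rw [combination_apply, Matrix.zero_vecMul, add_zero]
      ext1 w
      obtain rfl | hw := eq_or_ne w v
      · rw [Pi.single_eq_same, Pi.single_eq_same, Finset.sum_eq_single ⟨i, hi⟩]
        · simp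
        · intro i' _ hi'
          rw [Pi.single_eq_of_ne hi', map_zero, zero_mul]
        · simp
      · simp [Pi.single_eq_of_ne hw]
    let F : V → Q → IsLocalRing.ResidueField ℤ_[p] :=
      fun v x => f (Pi.single v (MonoidAlgebra.single x 1))
    have hF (v x y) (hxy : π x = π y) : F v x = F v y := by
      obtain ⟨h, rfl⟩ := hfib x y hxy
      have h1 := hinv ⟨ι h, h, rfl⟩ (Pi.single v (MonoidAlgebra.single y 1))
      change f (MonoidAlgebra.single (ι h) (1 : ℤ_[p]) • _) = _ at h1
      rwa [← Pi.single_smul, smul_eq_mul, MonoidAlgebra.single_mul_single, one_mul] at h1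
    -- The descent of `f` along `π`; by `hF` the choice of preimages is immaterial.
    let g : (V → MonoidAlgebra ℤ_[p] Q') →ₗ[ℤ_[p]] IsLocalRing.ResidueField ℤ_[p] :=
      { toFun := fun z => ∑ v, ∑ y, (z v).coeff y • F v (Function.surjInv hπ y)
        map_add' := fun z z' => by simp [add_smul, Finset.sum_add_distrib]
        map_smul' := fun c z => by simp [mul_smul, Finset.smul_sum] }
    have hg (z : V → MonoidAlgebra ℤ_[p] Q) :
        g (MonoidAlgebra.mapDomainAlgHom ℤ_[p] ℤ_[p] π ∘ z) = f z := by
      have : g ∘ₗ (MonoidAlgebra.mapDomainAlgHom ℤ_[p] ℤ_[p] π).toLinearMap.compLeft V = f := by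
        refine LinearMap.pi_ext fun v x => ?_
        induction x using MonoidAlgebra.induction_linear with
        | zero => simp
        | add x y hx hy => rw [Pi.single_add, map_add, map_add, hx, hy]
        | single x c =>
          have h1 : (MonoidAlgebra.mapDomainAlgHom ℤ_[p] ℤ_[p] π).toLinearMap.compLeft V
              (Pi.single v (MonoidAlgebra.single x c)) =
              Pi.single v (MonoidAlgebra.single (π x) c) := by
            ext1 w
            obtain rfl | hw := eq_or_ne w v
            · simp
            · simp [Pi.single_eq_of_ne hw]
          have h2 : f (Pi.single v (MonoidAlgebra.single x c)) = c • F v x := by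
            rw [← map_smul, ← Pi.single_smul, MonoidAlgebra.smul_single, smul_eq_mul, mul_one]
          rw [LinearMap.comp_apply, h1, h2]
          change ∑ w, ∑ y, _ = _
          rw [Finset.sum_eq_single v, Finset.sum_eq_single (π x)]
          · simp [hF v _ x (Function.surjInv_eq hπ (π x))]
          · intro y _ hy
            simp [Finsupp.single_eq_of_ne hy]
          · simp
          · intro w _ hw
            simp [Pi.single_eq_of_ne hw]
          · simp
      exact LinearMap.congr_fun this z
    have hgL (y) : g (y ᵥ* X.laplacian ℤ_[p] (π ∘ α)) = 0 := by
      choose z hz using fun v => mapDomain_surjective hπ (y v)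
      have h1 : MonoidAlgebra.mapDomainAlgHom ℤ_[p] ℤ_[p] π ∘ (z ᵥ* X.laplacian ℤ_[p] α) =
          y ᵥ* X.laplacian ℤ_[p] (π ∘ α) := by
        ext1 v
        have := RingHom.map_vecMul (MonoidAlgebra.mapDomainAlgHom ℤ_[p] ℤ_[p] π).toRingHom
          (X.laplacian ℤ_[p] α) z v
        rw [← X.laplacian_map ℤ_[p] α π]
        refine this.trans ?_
        congr 1
        exact funext hz
      rw [← h1, hg, hfL]
    have hgs (v) (x) : g (Pi.single v x) = 0 := by
      -- Terms of degree below `j` in `γ - 1` are killed by `hT`. The remainder `(γ - 1)^j y = d a y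
      -- + p b y` is killed too: its first part is in the row space, its second is a multiple of
      -- `p`.
      obtain ⟨c, y, rfl⟩ := exists_eq_sum_add hγ j x
      have hT (i) (hi : i < j) : g (Pi.single v (subOne ℤ_[p] (π γ) ^ i)) = 0 := by
        rw [← hfT v i hi, ← hg]
        congr 1
        ext1 w
        obtain rfl | hw := eq_or_ne w v
        · rw [Function.comp_apply, Pi.single_eq_same, Pi.single_eq_same, map_pow, mapDomain_subOne]
        · rw [Function.comp_apply, Pi.single_eq_of_ne hw, Pi.single_eq_of_ne hw, map_zero]
      have hlin : ∀ x, g (Pi.single v x) = (g ∘ₗ LinearMap.single ℤ_[p] _ v) x := fun _ => rfl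
      simp only [hlin] at hT ⊢
      rw [map_add, map_sum, Finset.sum_eq_zero, zero_add, hd, add_mul, map_add]
      · obtain ⟨y', hy'⟩ := hL v
        have e1 : (Pi.single v (d * a * y) : V → MonoidAlgebra ℤ_[p] Q') =
            ((a * y) • y') ᵥ* X.laplacian ℤ_[p] (π ∘ α) := by
          rw [Matrix.smul_vecMul, hy', ← Pi.single_smul, smul_eq_mul, mul_assoc,
            (commute_of_generator hγ _ _).eq]
        have e2 : (p : MonoidAlgebra ℤ_[p] Q') * b * y = (p : ℤ_[p]) • (b * y) := by
          rw [mul_assoc, ← nsmul_eq_mul, Nat.cast_smul_eq_nsmul]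
        rw [← hlin, e1, hgL, zero_add, e2, map_smul, residueField_smul_eq_zero]
      · intro i hi
        rw [map_smul, hT i (Finset.mem_range.1 hi), smul_zero]
    have hg0 : g = 0 := LinearMap.pi_ext fun v x => hgs v x
    refine LinearMap.ext fun z => ?_
    rw [← hg, hg0]
    rfl

end Level

/-! ### Compactness of the completed group ring -/

section Compactness

variable {p : ℕ} [Fact p.Prime] {K : Type*} [Group K] [TopologicalSpace K]

/-- The coefficients of an element of the completed group ring at all finite levels. -/
def IwasawaAlgebra.coeffs (x : IwasawaAlgebra p K)
    (s : Σ U : OpenNormalSubgroup K, K ⧸ U.toSubgroup) : ℤ_[p] :=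
  (proj p K s.1 x).coeff s.2

/-- The inverse limit topology on the completed group ring. -/
instance IwasawaAlgebra.topologicalSpace : TopologicalSpace (IwasawaAlgebra p K) :=
  TopologicalSpace.induced IwasawaAlgebra.coeffs inferInstance

lemma IwasawaAlgebra.proj_sum {ι : Type*} (s : Finset ι) (f : ι → IwasawaAlgebra p K)
    (U : OpenNormalSubgroup K) : proj p K U (∑ i ∈ s, f i) = ∑ i ∈ s, proj p K U (f i) := by
  classical
  induction s using Finset.induction_on with
  | empty => exact RingHom.map_zero _
  | insert a s ha ih => rw [Finset.sum_insert ha, Finset.sum_insert ha, RingHom.map_add, ih]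

lemma linear_apply_eq_sum {Q : Type*} [Fintype Q] (L : MonoidAlgebra ℤ_[p] Q →ₗ[ℤ_[p]] ℤ_[p])
    (x : MonoidAlgebra ℤ_[p] Q) : L x = ∑ a, x.coeff a * L (MonoidAlgebra.single a 1) := by
  induction x using MonoidAlgebra.induction_linear with
  | zero => simp
  | add x y hx hy => simp [hx, hy, add_mul, Finset.sum_add_distrib]
  | single a c =>
    rw [Finset.sum_eq_single a (fun b _ hb => by simp [Finsupp.single_eq_of_ne hb]) (by simp),
      ← smul_eq_mul, ← map_smul]
    simp

/-- The coefficient of an element of the group ring as a linear functional. -/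
def coeffLinear {Q : Type*} (a : Q) : MonoidAlgebra ℤ_[p] Q →ₗ[ℤ_[p]] ℤ_[p] where
  toFun x := x.coeff a
  map_add' _ _ := rfl
  map_smul' _ _ := rfl

lemma IwasawaAlgebra.continuous_linear_proj {U : OpenNormalSubgroup K} [Finite (K ⧸ U.toSubgroup)]
    (L : MonoidAlgebra ℤ_[p] (K ⧸ U.toSubgroup) →ₗ[ℤ_[p]] ℤ_[p]) :
    Continuous fun x : IwasawaAlgebra p K => L (proj p K U x) := by
  cases nonempty_fintype (K ⧸ U.toSubgroup)
  rw [show (fun x : IwasawaAlgebra p K => L (proj p K U x)) = _ from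
    funext fun x => linear_apply_eq_sum L _]
  refine continuous_finsetSum _ fun a _ => Continuous.mul ?_ continuous_const
  have h : Continuous fun f : (Σ U : OpenNormalSubgroup K, K ⧸ U.toSubgroup) → ℤ_[p] =>
      f ⟨U, a⟩ := continuous_apply _
  exact Continuous.comp (f := (coeffs : IwasawaAlgebra p K → _)) h continuous_induced_dom

/-- The coefficients embed the ring in a product of copies of the compact space `ℤ_p`. Each
compatibility condition is linear in finitely many coordinates, so the image is closed. -/
lemma IwasawaAlgebra.compactSpace (hfin : ∀ U : OpenNormalSubgroup K, Finite (K ⧸ U.toSubgroup)) :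
    CompactSpace (IwasawaAlgebra p K) := by
  have hinj : Function.Injective (coeffs : IwasawaAlgebra p K → _) := fun x y h =>
    ext_proj fun U => MonoidAlgebra.ext (Finsupp.ext fun a => congrFun h ⟨U, a⟩)
  let level (f : (Σ U : OpenNormalSubgroup K, K ⧸ U.toSubgroup) → ℤ_[p])
      (U : OpenNormalSubgroup K) : MonoidAlgebra ℤ_[p] (K ⧸ U.toSubgroup) :=
    have := hfin U
    MonoidAlgebra.ofCoeff (Finsupp.equivFunOnFinite.symm fun a => f ⟨U, a⟩)
  have hlevel (f U a) : (level f U).coeff a = f ⟨U, a⟩ := rfl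
  have hrange : Set.range (coeffs : IwasawaAlgebra p K → _) =
      ⋂ (U : OpenNormalSubgroup K) (W : OpenNormalSubgroup K) (h : U ≤ W) (b : K ⧸ W.toSubgroup),
        {f | (coeffLinear b ∘ₗ (transition p K h).toLinearMap) (level f U) = f ⟨W, b⟩} := by
    ext f
    simp only [Set.mem_iInter, Set.mem_range]
    constructor
    · rintro ⟨x, rfl⟩ U W h b
      have : level (coeffs x) U = proj p K U x := by
        ext a
        rfl
      change (transition p K h (level (coeffs x) U)).coeff b = (proj p K W x).coeff b
      rw [this, transition_proj]
    · intro hf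
      refine ⟨⟨level f, fun U W h => ?_⟩, ?_⟩
      · ext b
        exact hf U W h b
      · ext ⟨U, a⟩
        rfl
  have hclosed : Topology.IsClosedEmbedding (coeffs : IwasawaAlgebra p K → _) := by
    refine ⟨⟨⟨rfl⟩, hinj⟩, ?_⟩
    rw [hrange]
    refine isClosed_iInter fun U => isClosed_iInter fun W => isClosed_iInter fun h =>
      isClosed_iInter fun b => isClosed_eq ?_ (continuous_apply _)
    have := hfin U
    cases nonempty_fintype (K ⧸ U.toSubgroup)
    rw [show (fun f => (coeffLinear b ∘ₗ (transition p K h).toLinearMap) (level f U)) = _ from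
      funext fun f => linear_apply_eq_sum _ _]
    exact continuous_finsetSum _ fun a _ => (continuous_apply _).mul continuous_const
  exact hclosed.compactSpace

end Compactness

/-! ### Passage from finite levels to the limit -/

section FiniteGeneration

variable {p : ℕ} [Fact p.Prime] {G : Type*} [Group G] [TopologicalSpace G] {H : Subgroup G}

lemma isFinitelyGeneratedOver_of_forall_exists {M : Type*} [AddCommGroup M]
    [Module (IwasawaAlgebra p G) M] {ι : Type*} [Fintype ι] (s : ι → M)
    (h : ∀ m, ∃ c : ι → IwasawaAlgebra p H,
      m = ∑ i, IwasawaAlgebra.map p H.subtype continuous_subtype_val (c i) • s i) :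
    IsFinitelyGeneratedOver p H M := by
  let _ : Module (IwasawaAlgebra p H) M :=
    Module.compHom M (IwasawaAlgebra.map p H.subtype continuous_subtype_val)
  refine ⟨(Submodule.fg_def).2 ⟨Set.range s, Set.finite_range s, ?_⟩⟩
  rw [eq_top_iff]
  rintro m -
  obtain ⟨c, rfl⟩ := h m
  refine Submodule.sum_mem _ fun i _ => ?_
  exact Submodule.smul_mem (Submodule.span (IwasawaAlgebra p H) (Set.range s)) (c i)
    (Submodule.subset_span ⟨i, rfl⟩)

variable {V E : Type*} [Fintype V] [DecidableEq V] [Fintype E] (X : Multigraph V E) (α : E → G)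

/-- If the elements `(γ - 1)^i e_v` generate the cokernel of the Laplacian over `ℤ_p[H]` at every
finite level, then they generate it over `ℤ_p⟦H⟧`. -/
lemma exists_eq_sum_add_vecMul (hfinG : ∀ U : OpenNormalSubgroup G, Finite (G ⧸ U.toSubgroup))
    (hfinH : ∀ U : OpenNormalSubgroup H, Finite (H ⧸ U.toSubgroup)) (γ : G) (j : ℕ)
    (hlevel : ∀ U : OpenNormalSubgroup G, Function.Surjective (combination (p := p) X
      (QuotientGroup.mk' U.toSubgroup ∘ α) ((QuotientGroup.mk' U.toSubgroup).comp H.subtype)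
      (QuotientGroup.mk' U.toSubgroup γ) j)) (m : V → IwasawaAlgebra p G) :
    ∃ (c : V → Fin j → IwasawaAlgebra p H) (z : V → IwasawaAlgebra p G), m =
      (fun v => ∑ i, IwasawaAlgebra.map p H.subtype continuous_subtype_val (c v i) *
        toIwasawaAlgebra p G (subOne ℤ_[p] γ) ^ (i : ℕ)) +
      z ᵥ* (X.laplacian ℤ_[p] α).map (toIwasawaAlgebra p G) := by
  have := IwasawaAlgebra.compactSpace (p := p) hfinG
  have := IwasawaAlgebra.compactSpace (p := p) hfinH
  let F (x : (V → Fin j → IwasawaAlgebra p H) × (V → IwasawaAlgebra p G)) :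
      V → IwasawaAlgebra p G :=
    (fun v => ∑ i, IwasawaAlgebra.map p H.subtype continuous_subtype_val (x.1 v i) *
        toIwasawaAlgebra p G (subOne ℤ_[p] γ) ^ (i : ℕ)) +
      x.2 ᵥ* (X.laplacian ℤ_[p] α).map (toIwasawaAlgebra p G)
  have hF (U : OpenNormalSubgroup G) (x) (v : V) : IwasawaAlgebra.proj p G U (F x v) =
      ∑ i, MonoidAlgebra.mapDomainAlgHom ℤ_[p] ℤ_[p]
        (QuotientGroup.map (comapOpenNormal H.subtype continuous_subtype_val U).toSubgroup
          U.toSubgroup H.subtype le_rfl) (IwasawaAlgebra.proj p H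
            (comapOpenNormal H.subtype continuous_subtype_val U) (x.1 v i)) *
        subOne ℤ_[p] (QuotientGroup.mk' U.toSubgroup γ) ^ (i : ℕ) +
      ∑ w, IwasawaAlgebra.proj p G U (x.2 w) *
        X.laplacian ℤ_[p] (QuotientGroup.mk' U.toSubgroup ∘ α) w v := by
    have hFv : F x v = ∑ i, IwasawaAlgebra.map p H.subtype continuous_subtype_val (x.1 v i) *
        toIwasawaAlgebra p G (subOne ℤ_[p] γ) ^ (i : ℕ) +
        (x.2 ᵥ* (X.laplacian ℤ_[p] α).map (toIwasawaAlgebra p G)) v := rfl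
    rw [hFv, RingHom.map_add, IwasawaAlgebra.proj_sum]
    congr 1
    · refine Finset.sum_congr rfl fun i _ => ?_
      rw [RingHom.map_mul, RingHom.map_pow, IwasawaAlgebra.proj_toIwasawaAlgebra, mapDomain_subOne]
      rfl
    · exact congrFun (X.proj_vecMul_laplacian p α U x.2) v
  -- The solutions modulo level `U` form a directed family of nonempty closed subsets of a compact
  -- space; a common point solves the equation at all levels at once.
  let S (U : OpenNormalSubgroup G) : Set _ :=
    {x | ∀ v, IwasawaAlgebra.proj p G U (F x v) = IwasawaAlgebra.proj p G U (m v)}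
  have hSmono {U W : OpenNormalSubgroup G} (h : U ≤ W) : S U ⊆ S W := fun x hx v => by
    rw [← IwasawaAlgebra.transition_proj p h, hx v, IwasawaAlgebra.transition_proj]
  have hSclosed (U) : IsClosed (S U) := by
    have : S U = ⋂ (v : V) (a : G ⧸ U.toSubgroup),
        {x | coeffLinear a (IwasawaAlgebra.proj p G U (F x v)) =
          coeffLinear a (IwasawaAlgebra.proj p G U (m v))} := by
      ext x
      simp only [Set.mem_iInter]
      exact ⟨fun h v a => by rw [Set.mem_ofPred_eq, h v],
        fun h v => MonoidAlgebra.ext (Finsupp.ext fun a => h v a)⟩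
    rw [this]
    refine isClosed_iInter fun v => isClosed_iInter fun a => isClosed_eq ?_ continuous_const
    simp only [hF, map_add, map_sum]
    have := hfinG U
    have := hfinH (comapOpenNormal H.subtype continuous_subtype_val U)
    refine Continuous.add (continuous_finsetSum _ fun i _ => ?_)
      (continuous_finsetSum _ fun w _ => ?_)
    · have h1 := IwasawaAlgebra.continuous_linear_proj (coeffLinear a ∘ₗ
        LinearMap.mulRight ℤ_[p] (subOne ℤ_[p] (QuotientGroup.mk' U.toSubgroup γ) ^ (i : ℕ)) ∘ₗ
        (MonoidAlgebra.mapDomainAlgHom ℤ_[p] ℤ_[p] (QuotientGroup.map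
          (comapOpenNormal H.subtype continuous_subtype_val U).toSubgroup
          U.toSubgroup H.subtype le_rfl)).toLinearMap)
      exact h1.comp ((continuous_apply i).comp ((continuous_apply v).comp continuous_fst))
    · have h1 := IwasawaAlgebra.continuous_linear_proj (coeffLinear a ∘ₗ
        LinearMap.mulRight ℤ_[p] (X.laplacian ℤ_[p] (QuotientGroup.mk' U.toSubgroup ∘ α) w v))
      exact h1.comp ((continuous_apply w).comp continuous_snd)
  have hSne (U) : (S U).Nonempty := by
    -- Here `c` already has entries in the uncompleted ring `ℤ_p[H]`, and `z` lifts to `ℤ_p[G]`, so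
    -- both map to the completed rings.
    obtain ⟨⟨c, z⟩, hcz⟩ := hlevel U (IwasawaAlgebra.proj p G U ∘ m)
    choose z' hz' using fun v => mapDomain_surjective (QuotientGroup.mk'_surjective U.toSubgroup)
      (z v)
    refine ⟨(fun v i => toIwasawaAlgebra p H (c v i), fun v => toIwasawaAlgebra p G (z' v)),
      fun v => ?_⟩
    have h1 := congrFun hcz v
    rw [combination_apply] at h1
    rw [hF]
    refine Eq.trans ?_ h1
    rw [Pi.add_apply]
    congr 1
    · refine Finset.sum_congr rfl fun i _ => ?_
      congr 1
      rw [IwasawaAlgebra.proj_toIwasawaAlgebra, ← AlgHom.comp_apply,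
        ← MonoidAlgebra.mapDomainAlgHom_comp]
      rfl
    · refine Finset.sum_congr rfl fun w _ => ?_
      rw [IwasawaAlgebra.proj_toIwasawaAlgebra, hz']
  have hne : Nonempty (OpenNormalSubgroup G) :=
    ⟨{ toOpenSubgroup := ⊤, isNormal' := (inferInstance : (⊤ : Subgroup G).Normal) }⟩
  obtain ⟨x, hx⟩ := IsCompact.nonempty_iInter_of_directed_nonempty_isCompact_isClosed S
    (fun U W => ⟨U ⊓ W, hSmono inf_le_left, hSmono inf_le_right⟩) hSne
    (fun U => (hSclosed U).isCompact) hSclosed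
  refine ⟨x.1, x.2, funext fun v => IwasawaAlgebra.ext_proj fun U => ?_⟩
  exact (Set.mem_iInter.1 hx U v).symm

end FiniteGeneration

/-! ### Groups isomorphic to `ℤ_p` -/

section PadicGroup

variable {p : ℕ} [Fact p.Prime] {K : Type*} [Group K] [TopologicalSpace K]

/-- The `p`-adic integers are topologically generated by one element. -/
lemma exists_pow_eq_of_padic [IsTopologicalGroup K] (e : K ≃ₜ* Multiplicative ℤ_[p])
    (U : OpenNormalSubgroup K)
    (x : K ⧸ U.toSubgroup) :
    ∃ i : ℕ, x = (e.symm (Multiplicative.ofAdd 1) : K ⧸ U.toSubgroup) ^ i := by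
  obtain ⟨g, rfl⟩ := QuotientGroup.mk_surjective x
  have hcont : Continuous fun t : ℤ_[p] =>
      ((e.symm (Multiplicative.ofAdd t) : K) : K ⧸ U.toSubgroup) :=
    QuotientGroup.continuous_mk.comp (e.symm.continuous.comp continuous_ofAdd)
  have hdisc : DiscreteTopology (K ⧸ U.toSubgroup) := QuotientGroup.discreteTopology U.isOpen'
  have hopen := (isOpen_discrete {(g : K ⧸ U.toSubgroup)}).preimage hcont
  -- Each class of the discrete quotient pulls back to a nonempty open subset of `ℤ_p`, which
  -- contains a natural number.
  obtain ⟨n, hn⟩ := PadicInt.denseRange_natCast.exists_mem_open hopen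
    ⟨Multiplicative.toAdd (e g), by simp⟩
  refine ⟨n, ?_⟩
  rw [Set.mem_preimage, Set.mem_singleton_iff] at hn
  rw [← hn, ← QuotientGroup.mk_pow, ← map_pow, ← ofAdd_nsmul, nsmul_one]

/-- Intersecting `U` with the subgroup corresponding to `p^N ℤ_p` gives index at least `p^N > N`. -/
lemma exists_le_card_of_padic (e : K ≃ₜ* Multiplicative ℤ_[p])
    (hfin : ∀ U : OpenNormalSubgroup K, Finite (K ⧸ U.toSubgroup)) (U : OpenNormalSubgroup K)
    (N : ℕ) : ∃ W ≤ U, N ≤ Nat.card (K ⧸ W.toSubgroup) := by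
  let f : K →* Multiplicative (ZMod (p ^ N)) :=
    (AddMonoidHom.toMultiplicative (PadicInt.toZModPow (p := p) N).toAddMonoidHom).comp
      e.toMulEquiv.toMonoidHom
  have hf (g : K) : f g = Multiplicative.ofAdd (PadicInt.toZModPow N (Multiplicative.toAdd (e g))) :=
    rfl
  have hsurj : Function.Surjective f := by
    intro y
    obtain ⟨t, ht⟩ := ZMod.ringHom_surjective (PadicInt.toZModPow (p := p) N)
      (Multiplicative.toAdd y)
    refine ⟨e.symm (Multiplicative.ofAdd t), ?_⟩
    rw [hf, ContinuousMulEquiv.apply_symm_apply, toAdd_ofAdd, ht, ofAdd_toAdd]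
  have hopen : IsOpen (f.ker : Set K) := by
    have h1 : (f.ker : Set K) = (fun g => Multiplicative.toAdd (e g)) ⁻¹'
        Metric.closedBall (0 : ℤ_[p]) ((p : ℝ) ^ (-N : ℤ)) := by
      ext g
      rw [SetLike.mem_coe, MonoidHom.mem_ker, hf, ofAdd_eq_one, ← RingHom.mem_ker,
        PadicInt.ker_toZModPow, ← PadicInt.norm_le_pow_iff_mem_span_pow, Set.mem_preimage,
        mem_closedBall_zero_iff]
    rw [h1]
    refine (IsUltrametricDist.isOpen_closedBall _ ?_).preimage
      (continuous_toAdd.comp e.continuous)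
    exact (zpow_pos (Nat.cast_pos.2 (Fact.out (p := p.Prime)).pos) _).ne'
  let W₀ : OpenNormalSubgroup K :=
    { toSubgroup := f.ker
      isOpen' := hopen
      isNormal' := inferInstance }
  refine ⟨U ⊓ W₀, inf_le_left, ?_⟩
  have hle : (U ⊓ W₀).toSubgroup ≤ f.ker := fun x hx => hx.2
  have := hfin (U ⊓ W₀)
  have h2 := Nat.card_le_card_of_surjective (QuotientGroup.lift (U ⊓ W₀).toSubgroup f hle)
    (QuotientGroup.lift_surjective_of_surjective _ f hsurj hle)
  refine le_trans ?_ h2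
  rw [Nat.card_congr Multiplicative.toAdd, Nat.card_zmod]
  exact (Nat.lt_pow_self (Fact.out (p := p.Prime)).one_lt).le

end PadicGroup

/-! ### Finite quotients of `G` and of `G/H` -/

section Quotients

variable {p : ℕ} [Fact p.Prime] {G : Type*} [Group G] [TopologicalSpace G] [IsTopologicalGroup G]
  (H : Subgroup G) [H.Normal]

omit [Fact p.Prime] [IsTopologicalGroup G] in
lemma isPGroup_quotient_quotient (hG : ∀ U : OpenNormalSubgroup G, IsPGroup p (G ⧸ U.toSubgroup))
    (W : OpenNormalSubgroup (G ⧸ H)) : IsPGroup p ((G ⧸ H) ⧸ W.toSubgroup) := by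
  refine (hG (comapOpenNormal (QuotientGroup.mk' H) QuotientGroup.continuous_mk W)).of_surjective
    (QuotientGroup.map _ W.toSubgroup (QuotientGroup.mk' H) le_rfl) ?_
  intro x
  obtain ⟨x, rfl⟩ := QuotientGroup.mk_surjective x
  obtain ⟨x, rfl⟩ := QuotientGroup.mk_surjective x
  exact ⟨QuotientGroup.mk x, rfl⟩

/-- The image of an open normal subgroup in a quotient group. -/
def imageOpenNormal (U : OpenNormalSubgroup G) : OpenNormalSubgroup (G ⧸ H) where
  toSubgroup := U.toSubgroup.map (QuotientGroup.mk' H)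
  isOpen' := QuotientGroup.isOpenMap_coe _ U.isOpen'
  isNormal' := Subgroup.Normal.map inferInstance _ (QuotientGroup.mk'_surjective H)

/-- The projection `G/U → (G/H)/(UH/H)`. -/
def quotientProj (U : OpenNormalSubgroup G) :
    G ⧸ U.toSubgroup →* (G ⧸ H) ⧸ (imageOpenNormal H U).toSubgroup :=
  QuotientGroup.map _ _ (QuotientGroup.mk' H) (Subgroup.le_comap_map _ _)

lemma quotientProj_surjective (U : OpenNormalSubgroup G) :
    Function.Surjective (quotientProj H U) := by
  intro x
  obtain ⟨x, rfl⟩ := QuotientGroup.mk_surjective x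
  obtain ⟨x, rfl⟩ := QuotientGroup.mk_surjective x
  exact ⟨QuotientGroup.mk x, rfl⟩

lemma exists_eq_mul_of_quotientProj_eq (U : OpenNormalSubgroup G) (x y : G ⧸ U.toSubgroup)
    (hxy : quotientProj H U x = quotientProj H U y) :
    ∃ h : H, x = (QuotientGroup.mk' U.toSubgroup).comp H.subtype h * y := by
  obtain ⟨x, rfl⟩ := QuotientGroup.mk_surjective x
  obtain ⟨y, rfl⟩ := QuotientGroup.mk_surjective y
  have h1 : ((x⁻¹ * y : G) : G ⧸ H) ∈ U.toSubgroup.map (QuotientGroup.mk' H) :=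
    QuotientGroup.eq.1 hxy
  obtain ⟨u, hu, hux⟩ := h1
  have h2 : u⁻¹ * (x⁻¹ * y) ∈ H := QuotientGroup.eq.1 hux
  -- The witness is `x u y⁻¹`, written as a conjugate so that normality of `H` applies; times `y` it
  -- is `x u`, which is `x` modulo `U`.
  refine ⟨⟨y * (u⁻¹ * (x⁻¹ * y))⁻¹ * y⁻¹, ‹H.Normal›.conj_mem _ (inv_mem h2) y⟩, ?_⟩
  change (x : G ⧸ U.toSubgroup) = ((y * (u⁻¹ * (x⁻¹ * y))⁻¹ * y⁻¹ : G) : G ⧸ U.toSubgroup) * y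
  rw [← QuotientGroup.mk_mul, QuotientGroup.eq]
  have h3 : x⁻¹ * (y * (u⁻¹ * (x⁻¹ * y))⁻¹ * y⁻¹ * y) = u := by group
  rw [h3]
  exact hu

/-- A finite `p`-group quotient of `G` by an open subgroup factors through `G/G^{p^n}`. -/
lemma exists_powerSubgroup_le (U : OpenNormalSubgroup G) [Finite (G ⧸ U.toSubgroup)]
    (hU : IsPGroup p (G ⧸ U.toSubgroup)) : ∃ n, powerSubgroup p G n ≤ U.toSubgroup := by
  obtain ⟨n, hn⟩ := IsPGroup.iff_card.1 hU
  refine ⟨n, Subgroup.topologicalClosure_minimal _ ?_ U.toOpenSubgroup.isClosed⟩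
  rw [Subgroup.closure_le]
  rintro _ ⟨g, rfl⟩
  change g ^ p ^ n ∈ U.toSubgroup
  rw [← QuotientGroup.eq_one_iff, QuotientGroup.mk_pow, ← hn, pow_card_eq_one']

end Quotients

/-! ### Assembly of the main theorem -/

section Main

variable {p : ℕ} [Fact p.Prime] {G : Type*} [Group G] [TopologicalSpace G] [IsTopologicalGroup G]
  {V E : Type*} [Fintype V] [DecidableEq V] [Fintype E]

/-- If the cokernel of the Laplacian over `ℤ_p⟦K⟧`, with `K ≅ ℤ_p`, has vanishing `μ`-invariant,
then some element prime to `p` kills it. -/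
lemma exists_vecMul_laplacian_eq_single {K : Type*} [Group K] [TopologicalSpace K]
    [IsTopologicalGroup K] (X : Multigraph V E) (α : E → K) (e : K ≃ₜ* Multiplicative ℤ_[p])
    (hfin : ∀ U : OpenNormalSubgroup K, Finite (K ⧸ U.toSubgroup))
    (hp : ∀ U : OpenNormalSubgroup K, IsPGroup p (K ⧸ U.toSubgroup))
    (hconst : ∀ (U : OpenNormalSubgroup K) (F : V → K ⧸ U.toSubgroup → ℤ_[p]),
      (∀ e a, F (X.src e) a = F (X.tgt e) (a * α e)) → ∀ v w a b, F v a = F w b)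
    (hμ : muInvariant p (IwasawaAlgebra p K) (X.IwasawaPic p α) = 0) :
    ∃ d : IwasawaAlgebra p K, ¬ (p : IwasawaAlgebra p K) ∣ d ∧
      ∀ v, ∃ y, y ᵥ* (X.laplacian ℤ_[p] α).map (toIwasawaAlgebra p K) = Pi.single v d := by
  have hgen := exists_pow_eq_of_padic e
  have hbig := exists_le_card_of_padic e hfin
  refine exists_vecMul_eq_single (IwasawaAlgebra.mul_comm_of_generator hgen)
    (fun x y => IwasawaAlgebra.natCast_dvd_or_dvd hfin hp hgen hbig) ?_
    (fun x y => IwasawaAlgebra.natCast_mul_cancel)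
    (fun x => IwasawaAlgebra.eq_zero_of_forall_pow_dvd) _
    (fun z => X.laplacian_injective p α hfin hp hbig hconst)
    (X.generators α (toIwasawaAlgebra p K)) (X.generators_surjective α _)
    (fun z => ⟨X.mem_range_of_generators_eq_zero α _, ?_⟩) hμ
  · rw [IwasawaAlgebra.natCast_dvd_iff hfin]
    intro h
    have U : OpenNormalSubgroup K :=
      { toOpenSubgroup := ⊤, isNormal' := (inferInstance : (⊤ : Subgroup K).Normal) }
    have h1 := h U
    rw [map_one, map_one] at h1
    exact one_ne_zero h1
  · rintro ⟨y, rfl⟩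
    exact X.generators_vecMul α _ y

/-- If the `μ`-invariant of the Picard module of the `ℤ_p`-subcover vanishes, then finitely many
explicit elements generate the cokernel of the Laplacian of the full tower over `ℤ_p⟦H⟧`. -/
lemma exists_forall_eq_sum_add_vecMul [CompactSpace G]
    (hG : ∀ U : OpenNormalSubgroup G, IsPGroup p (G ⧸ U.toSubgroup))
    (X : Multigraph V E) (α : E → G)
    (hconn : ∀ n : ℕ, (X.derived fun e => (α e : G ⧸ powerSubgroup p G n)).Connected)
    (H : Subgroup G) [H.Normal] (e : G ⧸ H ≃ₜ* Multiplicative ℤ_[p])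
    (hμ : muInvariant p (IwasawaAlgebra p (G ⧸ H)) (X.IwasawaPic p fun e => (α e : G ⧸ H)) = 0) :
    ∃ (γ : G) (j : ℕ), ∀ m : V → IwasawaAlgebra p G,
      ∃ (c : V → Fin j → IwasawaAlgebra p H) (z : V → IwasawaAlgebra p G), m =
        (fun v => ∑ i, IwasawaAlgebra.map p H.subtype continuous_subtype_val (c v i) *
          toIwasawaAlgebra p G (subOne ℤ_[p] γ) ^ (i : ℕ)) +
        z ᵥ* (X.laplacian ℤ_[p] α).map (toIwasawaAlgebra p G) := by
  have hfinG (U : OpenNormalSubgroup G) : Finite (G ⧸ U.toSubgroup) :=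
    Subgroup.quotient_finite_of_isOpen _ U.isOpen'
  have hfin (W : OpenNormalSubgroup (G ⧸ H)) : Finite ((G ⧸ H) ⧸ W.toSubgroup) :=
    Subgroup.quotient_finite_of_isOpen _ W.isOpen'
  have hp := isPGroup_quotient_quotient H hG
  -- Closedness of `H` comes from `G/H ≅ ℤ_p` being `T1`; it makes `H` compact, so that its open
  -- quotients are finite.
  have hclosed : IsClosed (H : Set G) := by
    have : T1Space (G ⧸ H) := e.toHomeomorph.symm.t1Space
    have h1 : (H : Set G) = (QuotientGroup.mk : G → G ⧸ H) ⁻¹' {1} := by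
      ext g
      simp
    rw [h1]
    exact isClosed_singleton.preimage QuotientGroup.continuous_mk
  have : CompactSpace H := isCompact_iff_compactSpace.1 hclosed.isCompact
  have hfinH (U : OpenNormalSubgroup H) : Finite (H ⧸ U.toSubgroup) :=
    Subgroup.quotient_finite_of_isOpen _ U.isOpen'
  -- Connectedness is assumed only for the levels `G/G^{p^n}`, but each finite quotient of `G/H` by
  -- an open subgroup is a quotient of one of these.
  have hconst (W : OpenNormalSubgroup (G ⧸ H)) (F : V → (G ⧸ H) ⧸ W.toSubgroup → ℤ_[p])
      (hF : ∀ e a, F (X.src e) a = F (X.tgt e) (a * ((α e : G ⧸ H) : (G ⧸ H) ⧸ W.toSubgroup)))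
      (v w a b) : F v a = F w b := by
    let U := comapOpenNormal (QuotientGroup.mk' H) QuotientGroup.continuous_mk W
    have := hfinG U
    obtain ⟨n, hn⟩ := exists_powerSubgroup_le (p := p) U (hG U)
    refine X.eq_of_connected (fun e => ((α e : G ⧸ H) : (G ⧸ H) ⧸ W.toSubgroup)) (hconn n)
      (π := QuotientGroup.lift _
        ((QuotientGroup.mk' W.toSubgroup).comp (QuotientGroup.mk' H)) fun g hg => ?_)
      ?_ (fun e => rfl) hF v w a b
    · exact (QuotientGroup.eq_one_iff _).2 (hn hg)
    · intro x
      obtain ⟨x, rfl⟩ := QuotientGroup.mk_surjective x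
      obtain ⟨x, rfl⟩ := QuotientGroup.mk_surjective x
      exact ⟨QuotientGroup.mk x, rfl⟩
  obtain ⟨d, hd, hdL⟩ := exists_vecMul_laplacian_eq_single X _ e hfin hp hconst hμ
  obtain ⟨γ, hγ⟩ := QuotientGroup.mk_surjective (e.symm (Multiplicative.ofAdd 1))
  have hgen := exists_pow_eq_of_padic e
  rw [← hγ] at hgen
  obtain ⟨j, hj⟩ := IwasawaAlgebra.exists_subOne_pow_eq hfin hp hgen hd
  refine ⟨γ, j, exists_eq_sum_add_vecMul X α hfinG hfinH γ j fun U => ?_⟩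
  have := hfinG U
  obtain ⟨a, b, hab⟩ := hj (imageOpenNormal H U)
  refine combination_surjective X _ (hG U) (quotientProj_surjective H U)
    (exists_eq_mul_of_quotientProj_eq H U) (hgen (imageOpenNormal H U)) hab fun v => ?_
  obtain ⟨y, hy⟩ := hdL v
  refine ⟨IwasawaAlgebra.proj p _ (imageOpenNormal H U) ∘ y, ?_⟩
  have h1 := Multigraph.proj_vecMul_laplacian p X (fun e => (α e : G ⧸ H)) (imageOpenNormal H U) y
  refine h1.symm.trans ?_
  rw [hy]
  ext1 w
  obtain rfl | hw := eq_or_ne w v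
  · simp
  · rw [Function.comp_apply, Pi.single_eq_of_ne hw, Pi.single_eq_of_ne hw]
    exact RingHom.map_zero _

omit [IsTopologicalGroup G] [Fintype E] in
lemma exists_forall_eq_sum_smul {M : Type*} [AddCommGroup M] [Module (IwasawaAlgebra p G) M]
    {L : Matrix V V (IwasawaAlgebra p G)} (π : (V → IwasawaAlgebra p G) →ₗ[IwasawaAlgebra p G] M)
    (hπ : Function.Surjective π) (hL : ∀ z, π (z ᵥ* L) = 0) {H : Subgroup G} {t : IwasawaAlgebra p G}
    {j : ℕ} (h : ∀ m : V → IwasawaAlgebra p G,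
      ∃ (c : V → Fin j → IwasawaAlgebra p H) (z : V → IwasawaAlgebra p G), m =
        (fun v => ∑ i, IwasawaAlgebra.map p H.subtype continuous_subtype_val (c v i) *
          t ^ (i : ℕ)) + z ᵥ* L) :
    ∃ s : V × Fin j → M, ∀ m, ∃ c : V × Fin j → IwasawaAlgebra p H,
      m = ∑ i, IwasawaAlgebra.map p H.subtype continuous_subtype_val (c i) • s i := by
  refine ⟨fun x => π (Pi.single x.1 (t ^ (x.2 : ℕ))), fun m => ?_⟩
  obtain ⟨m, rfl⟩ := hπ m
  obtain ⟨c, z, rfl⟩ := h m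
  refine ⟨fun x => c x.1 x.2, ?_⟩
  rw [map_add, hL, add_zero, Fintype.sum_prod_type]
  conv_lhs => rw [← Finset.univ_sum_single (fun v => ∑ i,
    IwasawaAlgebra.map p H.subtype continuous_subtype_val (c v i) * t ^ (i : ℕ))]
  rw [map_sum]
  refine Finset.sum_congr rfl fun v _ => ?_
  simp only [← map_smul, ← Pi.single_smul, smul_eq_mul, ← map_sum]
  congr 1
  exact map_sum (AddMonoidHom.single (fun _ : V => IwasawaAlgebra p G) v) _ _

set_option synthInstance.maxHeartbeats 400000 in
omit [IsTopologicalGroup G] in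
lemma isFinitelyGeneratedOver_quotient {M : Type*} [AddCommGroup M]
    [Module (IwasawaAlgebra p G) M] {H : Subgroup G} {ι : Type*} [Fintype ι] (s : ι → M)
    (hs : ∀ m, ∃ c : ι → IwasawaAlgebra p H,
      m = ∑ i, IwasawaAlgebra.map p H.subtype continuous_subtype_val (c i) • s i)
    (N : Submodule (IwasawaAlgebra p G) M) : IsFinitelyGeneratedOver p H (M ⧸ N) := by
  refine isFinitelyGeneratedOver_of_forall_exists (fun i => N.mkQ (s i)) fun m => ?_
  obtain ⟨m, rfl⟩ := N.mkQ_surjective m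
  obtain ⟨c, rfl⟩ := hs m
  refine ⟨c, ?_⟩
  rw [map_sum]
  exact Finset.sum_congr rfl fun i _ => map_smul _ _ _

set_option synthInstance.maxHeartbeats 400000 in
/-- The Picard module of the tower is finitely generated over `ℤ_p⟦H⟧`, and so are its quotients. -/
lemma isFinitelyGeneratedOver_iwasawaPic [CompactSpace G]
    (hG : ∀ U : OpenNormalSubgroup G, IsPGroup p (G ⧸ U.toSubgroup))
    (X : Multigraph V E) (α : E → G)
    (hconn : ∀ n : ℕ, (X.derived fun e => (α e : G ⧸ powerSubgroup p G n)).Connected)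
    (H : Subgroup G) [H.Normal] (e : G ⧸ H ≃ₜ* Multiplicative ℤ_[p])
    (hμ : muInvariant p (IwasawaAlgebra p (G ⧸ H)) (X.IwasawaPic p fun e => (α e : G ⧸ H)) = 0) :
    SatisfiesMHG p H (X.IwasawaPic p α) ∧ IsFinitelyGeneratedOver p H (X.IwasawaPic p α) := by
  obtain ⟨γ, j, h⟩ := exists_forall_eq_sum_add_vecMul hG X α hconn H e hμ
  obtain ⟨s, hs⟩ := exists_forall_eq_sum_smul _
    (X.generators_surjective α (toIwasawaAlgebra p G)) (X.generators_vecMul α _) h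
  exact ⟨isFinitelyGeneratedOver_quotient s hs _, isFinitelyGeneratedOver_of_forall_exists s hs⟩

end Main

end VoltageCover

end

theorem corollary8p2 (p : ℕ) [Fact p.Prime] (l : ℕ)
    {G : Type*} [Group G] [TopologicalSpace G] [IsTopologicalGroup G]
    (hG : VoltageCover.IsUniform p G l)
    {V E : Type*} [Finite V] [Finite E] (X : VoltageCover.Multigraph V E) (α : E → G)
    (hconn : ∀ n : ℕ,
      (X.derived fun e => (α e : G ⧸ VoltageCover.powerSubgroup p G n)).Connected)
    (H : Subgroup G) [H.Normal] (hH : Nonempty (G ⧸ H ≃ₜ* Multiplicative ℤ_[p]))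
    (hμ : VoltageCover.muInvariant p (VoltageCover.IwasawaAlgebra p (G ⧸ H))
      (X.IwasawaPic p fun e => (α e : G ⧸ H)) = 0) :
    VoltageCover.SatisfiesMHG p H (X.IwasawaPic p α) ∧
      VoltageCover.IsFinitelyGeneratedOver p H (X.IwasawaPic p α) := by
  classical
  cases nonempty_fintype V
  cases nonempty_fintype E
  obtain ⟨e⟩ := hH
  have := hG.compactSpace
  exact VoltageCover.isFinitelyGeneratedOver_iwasawaPic hG.proP X α hconn H e hμ
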